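/- Let $\alpha,\beta\in\mathbb{R}$, let $\{Z_n\}_{n\ge1}$ be a sequence of i.i.d. Gaussian random variables $N(\alpha,\beta^2)$, and let $\{a_n\}_{n\ge1}$, $\{b_n\}_{n\ge1}$ be two non-increasing sequences of positive real numbers with $\sum_{n=1}^\infty a_n<\infty$ and $\sum_{n=1}^\infty b_n<\infty$. Write $\|a\|_2=\left(\sum_{n=1}^\infty a_n^2\right)^{1/2}$ and $\|b\|_2=\left(\sum_{n=1}^\infty b_n^2\right)^{1/2}$. Suppose that the series $$\sum_{n=1}^{\infty}\left(1-\frac{a_n/\|a\|_2}{b_n/\|b\|_2}\right)$$ converges (possibly only conditionally), and that $$\sum_{n=1}^{\infty}\left(1-\frac{a_n/\|a\|_2}{b_n/\|b\|_2}\right)^2<\infty.$$ Then the series $\sum_{n=1}^\infty a_n|Z_n|$ and $\sum_{n=1}^\infty b_n|Z_n|$ converge almost surely, and, as $r\to\infty$, $$\mathbb{P}\left\{\sum_{n=1}^{\infty}a_n|Z_n|\ge r\|a\|_2\beta+|\alpha|\sum_{n=1}^{\infty}a_n\right\}\sim\mathbb{P}\left\{\sum_{n=1}^{\infty}b_n|Z_n|\ge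 r\|b\|_2\beta+|\alpha|\sum_{n=1}^{\infty}b_n\right\},$$ where $f(r)\sim g(r)$ means $f(r)/g(r)\to1$. -/

import Mathlib

open MeasureTheory ProbabilityTheory Filter Topology Asymptotics

noncomputable section

/-- The `ℓ²` norm `(∑ aₙ²)^{1/2}` of a (square-summable) real sequence. -/
def l2Norm (a : ℕ → ℝ) : ℝ := Real.sqrt (∑' n, a n ^ 2)

/-- The upper tail probability `P{∑ aₙ|Zₙ| ≥ r‖a‖₂β + |α| ∑ aₙ}`. -/
def upperTail {Ω : Type*} [MeasurableSpace Ω] (P : Measure Ω) (Z : ℕ → Ω → ℝ)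
    (α β : ℝ) (a : ℕ → ℝ) (r : ℝ) : ℝ :=
  P.real {ω | r * l2Norm a * β + |α| * ∑' n, a n ≤ ∑' n, a n * |Z n ω|}

/-- The term `1 - (aₙ/‖a‖₂)/(bₙ/‖b‖₂)`. -/
def relDefect (a b : ℕ → ℝ) (n : ℕ) : ℝ :=
  1 - (a n / l2Norm a) / (b n / l2Norm b)

end

/-! For `β > 0` put `δ = |α|/β` and `Yₙ = |Zₙ|/β - δ`. The event becomes `∑ (aₙ/‖a‖₂) Yₙ ≥ r`, a
tail of a weighted sum whose weights have ℓ² norm one. Completing the square in the density of `Y`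
gives `E exp(xY) = exp(x²/2) m(x)`, where `m = foldedMass δ` is a bounded correction to the Gaussian
moment generating function.

Tail of one sum (`tendsto_tail_div`). Tilting by `exp(r·)` moves the sum to a law asymptotic to
`N(r, 1)`, which suggests the tail `exp(-r²/2) ∏ m(r aₙ) / (r √(2π))`. The tail integral lives at
distance `1/r` from the threshold, a scale that weak convergence alone does not see. So the summand
with index `0` is kept apart: its explicit density gives the tail conditionally on the other
summands (`foldedLaw_real_tail_eq`, `abs_tiltedTail_sub_le`), and only a smooth function of these
others remains to be averaged, for which convergence of characteristic functions is enough
(`tendsto_tilted_charFun`, `tendsto_integral_tilted_stdPDF`).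

Comparison of two sums (`tendsto_tsum_sub_tsum_of_relative_perturbation`). The ratio of the two
tails tends to the limit of the exponential of `∑ L(r aₙ) - ∑ L(r bₙ)` for the normalised weights,
with `L = log m`. Writing `aₙ = bₙ(1 - dₙ)`, Taylor's formula gives `L(r aₙ) - L(r bₙ) = -dₙ F(r bₙ)
+ O(dₙ²)` with `F(x) = x L'(x)`. The remainders vanish one by one and are dominated by the summable
`dₙ²`. The linear part involves a possibly conditionally convergent series `∑ dₙ`, but `n ↦ F(r bₙ)`
has variation bounded uniformly in `r`, since `b` is monotone and `F' = O((1+x)⁻²)`, so summation by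
parts disposes of it. -/

/-! ### Real analysis: comparing `∑ L(r aₙ)` with `∑ L(r bₙ)` -/

/-- A function whose derivative is bounded by `C / (1 + x)²` on `[0, ∞)` varies at most as much as
`C / (1 + x)` does. -/
lemma abs_sub_le_of_deriv_le_inv_sq {f f' : ℝ → ℝ} {C : ℝ}
    (hf : ∀ x, 0 ≤ x → HasDerivAt f (f' x) x)
    (hb : ∀ x, 0 ≤ x → |f' x| ≤ C / (1 + x) ^ 2) {x y : ℝ} (hx : 0 ≤ x) (hxy : x ≤ y) :
    |f y - f x| ≤ C * (1 / (1 + x) - 1 / (1 + y)) := by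
  have hg : ∀ z, 0 ≤ z → HasDerivAt (fun z : ℝ => -C * (1 + z)⁻¹) (C / (1 + z) ^ 2) z := by
    intro z hz
    have h1 : HasDerivAt (fun z : ℝ => 1 + z) 1 z := (hasDerivAt_id z).const_add 1
    exact ((h1.fun_inv (by positivity)).const_mul (-C)).congr_deriv (by ring)
  -- Both `f` and `-f` become monotone after adding `-C/(1+z)`; the signs `s = 1` and `s = -1` give
  -- the two halves of the absolute value.
  have key : ∀ s : ℝ, |s| = 1 → s * f x + -C * (1 + x)⁻¹ ≤ s * f y + -C * (1 + y)⁻¹ := by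
    intro s hs
    have hd : ∀ z, 0 ≤ z → HasDerivAt (fun z => s * f z + -C * (1 + z)⁻¹)
        (s * f' z + C / (1 + z) ^ 2) z := fun z hz => ((hf z hz).const_mul s).add (hg z hz)
    have hm : MonotoneOn (fun z => s * f z + -C * (1 + z)⁻¹) (Set.Ici 0) := by
      apply monotoneOn_of_deriv_nonneg (convex_Ici 0)
      · exact fun z hz => (hd z hz).continuousAt.continuousWithinAt
      · intro z hz
        rw [interior_Ici] at hz
        exact (hd z (le_of_lt hz)).differentiableAt.differentiableWithinAt
      · intro z hz
        rw [interior_Ici] at hz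
        rw [(hd z (le_of_lt hz)).deriv]
        have h1 := hb z (le_of_lt hz)
        have h2 : -|s * f' z| ≤ s * f' z := neg_abs_le _
        rw [abs_mul, hs, one_mul] at h2
        linarith
    exact hm hx (hx.trans hxy) hxy
  have h1 := key 1 (by simp)
  have h2 := key (-1) (by simp)
  rw [abs_le]
  constructor <;> simp only [one_div] <;> nlinarith

/-- First-order Taylor estimate with a relative error, for a function whose second derivative is
`O((1 + x)⁻³)`. -/
lemma abs_taylor_le_of_second_deriv {L L' L'' : ℝ → ℝ} {C : ℝ}
    (hL : ∀ x, 0 ≤ x → HasDerivAt L (L' x) x) (hL' : ∀ x, 0 ≤ x → HasDerivAt L' (L'' x) x)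
    (hC : 0 ≤ C)
    (hb : ∀ x, 0 ≤ x → |L'' x| ≤ C / (1 + x) ^ 3) {x y : ℝ} (hx : 0 < x) (hxy : x / 2 ≤ y) :
    |L y - L x - (y - x) * L' x| ≤ 4 * C * ((y - x) / x) ^ 2 := by
  -- On `z ≥ x/2` one has `x² ≤ 4z² ≤ 4(1+z)³`, hence the constant `4C/x²`.
  have hbd : ∀ z ∈ Set.Ici (x / 2), |L'' z| ≤ 4 * C / x ^ 2 := by
    intro z hz
    have hz' : x / 2 ≤ z := hz
    have hz0 : 0 < 1 + z := by linarith
    refine (hb z (by linarith)).trans ?_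
    rw [div_le_div_iff₀ (by positivity) (by positivity)]
    have : x ^ 2 ≤ 4 * (1 + z) ^ 3 := by
      have h0 : 0 < z := by linarith
      nlinarith [mul_pos h0 h0, mul_pos (mul_pos h0 h0) h0]
    nlinarith
  have hlip : ∀ z ∈ Set.Ici (x / 2), |L' z - L' x| ≤ 4 * C / x ^ 2 * |z - x| := by
    intro z hz
    have := Convex.norm_image_sub_le_of_norm_hasDerivWithin_le (f := L') (f' := L'')
      (s := Set.Ici (x / 2)) (x := x) (y := z) (C := 4 * C / x ^ 2)
      (fun w hw => (hL' w (by have : x / 2 ≤ w := hw; linarith)).hasDerivWithinAt)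
      hbd (convex_Ici _) (by simp; linarith) hz
    simpa using this
  have hsub : ∀ z ∈ Set.uIcc x y, z ∈ Set.Ici (x / 2) := by
    intro z hz
    rw [Set.mem_uIcc] at hz
    simp only [Set.mem_Ici]
    rcases hz with h | h <;> linarith
  have := Convex.norm_image_sub_le_of_norm_hasDerivWithin_le (f := fun z => L z - z * L' x)
      (f' := fun z => L' z - L' x)
      (s := Set.uIcc x y) (x := x) (y := y) (C := 4 * C / x ^ 2 * |y - x|)
      (fun w hw => ((hL w (by have : x / 2 ≤ w := hsub w hw; linarith)).sub
        ((hasDerivAt_id w).mul_const (L' x) |>.congr_deriv (by simp))).hasDerivWithinAt)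
      (by
        intro z hz
        refine (hlip z (hsub z hz)).trans ?_
        exact mul_le_mul_of_nonneg_left (Set.abs_sub_left_of_mem_uIcc hz) (by positivity)) (convex_uIcc _ _) Set.left_mem_uIcc
      Set.right_mem_uIcc
  simp only [Real.norm_eq_abs] at this
  calc |L y - L x - (y - x) * L' x| = |L y - y * L' x - (L x - x * L' x)| := by ring_nf
    _ ≤ _ := this
    _ = 4 * C * ((y - x) / x) ^ 2 := by
      rw [mul_assoc, abs_mul_abs_self, div_pow]; ring

/-- Abel summation: weights that tend to `0` termwise and have uniformly bounded variation kill a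
convergent series. -/
lemma tendsto_tsum_mul_of_bounded_variation {d : ℕ → ℝ} {L : ℝ}
    (hd : Tendsto (fun N => ∑ n ∈ Finset.range N, d n) atTop (𝓝 L))
    {f : ℝ → ℕ → ℝ} {C : ℝ} (hf0 : ∀ n, Tendsto (fun r => f r n) atTop (𝓝 0))
    (hfC : ∀ᶠ r in atTop, ∀ N, ∑ n ∈ Finset.range N, |f r (n + 1) - f r n| ≤ C)
    (hfb : ∀ᶠ r in atTop, ∀ n, |f r n| ≤ C)
    (hs : ∀ᶠ r in atTop, Summable fun n => d n * f r n) :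
    Tendsto (fun r => ∑' n, d n * f r n) atTop (𝓝 0) := by
  -- Subtracting the limit makes the partial sums tend to `0`, so that beyond some index they are
  -- uniformly small factors in the summation by parts.
  set D : ℕ → ℝ := fun n => ∑ k ∈ Finset.range n, d k - L with hD
  have hD0 : Tendsto D atTop (𝓝 0) := by
    have := hd.sub_const L
    simpa using this
  have parts : ∀ r N, ∑ n ∈ Finset.range N, d n * f r n =
      D N * f r N - D 0 * f r 0 - ∑ n ∈ Finset.range N, D (n + 1) * (f r (n + 1) - f r n) := by
    intro r N
    induction N with
    | zero => simp
    | succ N ih =>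
      rw [Finset.sum_range_succ, ih, Finset.sum_range_succ]
      have : d N = D (N + 1) - D N := by simp [hD, Finset.sum_range_succ]
      rw [this]; ring
  rw [Metric.tendsto_atTop']
  have hC0 : 0 ≤ C := by
    obtain ⟨r, hr⟩ := hfC.exists
    simpa using hr 0
  intro ε hε
  -- Beyond `N₀` the variation contributes at most `η C`, and the boundary term `D N * f r N`
  -- another `η C`. The `+ 4` in the witness covers `C = 0`.
  obtain ⟨η, hη, hηε⟩ : ∃ η > 0, η * (2 * C) < ε / 2 := by
    refine ⟨ε / (4 * C + 4), by positivity, ?_⟩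
    rw [div_mul_eq_mul_div, div_lt_div_iff₀ (by positivity) (by positivity)]
    nlinarith
  obtain ⟨N₀, hN₀⟩ := (Metric.tendsto_atTop.1 hD0) η hη
  have hfin : Tendsto (fun r => |D 0 * f r 0| +
      ∑ n ∈ Finset.range N₀, |D (n + 1) * (f r (n + 1) - f r n)|) atTop (𝓝 0) := by
    have h1 : Tendsto (fun r => |D 0 * f r 0|) atTop (𝓝 0) := by
      simpa using ((hf0 0).const_mul (D 0)).abs
    have h2 : Tendsto (fun r => ∑ n ∈ Finset.range N₀, |D (n + 1) * (f r (n + 1) - f r n)|)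
        atTop (𝓝 0) := by
      have : ∀ n ∈ Finset.range N₀,
          Tendsto (fun r => |D (n + 1) * (f r (n + 1) - f r n)|) atTop (𝓝 0) := by
        intro n _
        simpa using ((((hf0 (n + 1)).sub (hf0 n))).const_mul (D (n + 1))).abs
      simpa using tendsto_finsetSum (Finset.range N₀) this
    simpa using h1.add h2
  have hev := hfin.eventually (gt_mem_nhds (show (0 : ℝ) < ε / 4 by positivity))
  obtain ⟨r₀, hr₀⟩ := eventually_atTop.1 (hev.and (hfC.and (hfb.and hs)))
  refine ⟨r₀, fun r hr => ?_⟩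
  obtain ⟨h1, h2, h3, h4⟩ := hr₀ r hr.le
  have hbound : ∀ N, N₀ ≤ N → |∑ n ∈ Finset.range N, d n * f r n| ≤ ε / 4 + η * (2 * C) := by
    intro N hN
    rw [parts]
    have hsplit : |∑ n ∈ Finset.range N, D (n + 1) * (f r (n + 1) - f r n)| ≤
        ∑ n ∈ Finset.range N₀, |D (n + 1) * (f r (n + 1) - f r n)| + η * C := by
      refine (Finset.abs_sum_le_sum_abs _ _).trans ?_
      rw [← Finset.sum_range_add_sum_Ico _ hN]
      gcongr
      calc ∑ n ∈ Finset.Ico N₀ N, |D (n + 1) * (f r (n + 1) - f r n)|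
          ≤ ∑ n ∈ Finset.Ico N₀ N, η * |f r (n + 1) - f r n| := by
            apply Finset.sum_le_sum
            intro n hn
            rw [abs_mul]
            gcongr
            have := hN₀ (n + 1) (by have := (Finset.mem_Ico.1 hn).1; omega)
            simpa using this.le
        _ ≤ ∑ n ∈ Finset.range N, η * |f r (n + 1) - f r n| := by
            apply Finset.sum_le_sum_of_subset_of_nonneg
            · intro n hn
              simp only [Finset.mem_Ico, Finset.mem_range] at *
              exact hn.2
            · intros; positivity
        _ ≤ η * C := by
            rw [← Finset.mul_sum]
            exact mul_le_mul_of_nonneg_left (h2 N) hη.le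
    have hlast : |D N * f r N| ≤ η * C := by
      rw [abs_mul]
      have := hN₀ N hN
      rw [Real.dist_eq, sub_zero] at this
      exact mul_le_mul this.le (h3 N) (abs_nonneg _) hη.le
    have t1 := abs_sub (D N * f r N - D 0 * f r 0)
      (∑ n ∈ Finset.range N, D (n + 1) * (f r (n + 1) - f r n))
    have t2 := abs_sub (D N * f r N) (D 0 * f r 0)
    linarith
  have hlim := h4.hasSum.tendsto_sum_nat.abs
  have hle : |∑' n, d n * f r n| ≤ ε / 4 + η * (2 * C) :=
    le_of_tendsto hlim (eventually_atTop.2 ⟨N₀, hbound⟩)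
  rw [Real.dist_eq, sub_zero]
  linarith

/-- If `∑ d n` converges and `∑ d n ^ 2 < ∞`, replacing the weights `b n` by `b n * (1 - d n)` does
not change `∑ L (r * b n)` asymptotically. -/
lemma tendsto_tsum_sub_tsum_of_relative_perturbation {L L' L'' : ℝ → ℝ} {C : ℝ}
    (hL0 : L 0 = 0) (hC : 0 ≤ C)
    (hL : ∀ x, 0 ≤ x → HasDerivAt L (L' x) x) (hL' : ∀ x, 0 ≤ x → HasDerivAt L' (L'' x) x)
    (hb1 : ∀ x, 0 ≤ x → |L' x| ≤ C / (1 + x) ^ 3)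
    (hb2 : ∀ x, 0 ≤ x → |L'' x| ≤ C / (1 + x) ^ 3)
    {a b d : ℕ → ℝ} (ha_pos : ∀ n, 0 < a n) (hb_pos : ∀ n, 0 < b n) (hb_anti : Antitone b)
    (ha : Summable a) (hb : Summable b) (hd : ∀ n, a n = b n * (1 - d n))
    (hconv : ∃ l, Tendsto (fun N => ∑ n ∈ Finset.range N, d n) atTop (𝓝 l))
    (hsq : Summable fun n => d n ^ 2) :
    Tendsto (fun r => ∑' n, L (r * a n) - ∑' n, L (r * b n)) atTop (𝓝 0) := by
  have hpow : ∀ x : ℝ, 0 ≤ x → C / (1 + x) ^ 3 ≤ C / (1 + x) ^ 2 := by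
    intro x hx
    exact div_le_div_of_nonneg_left hC (by positivity)
      (pow_le_pow_right₀ (by linarith) (by norm_num))
  have hvarL : ∀ x y, 0 ≤ x → x ≤ y → |L y - L x| ≤ C * (1 / (1 + x) - 1 / (1 + y)) :=
    fun x y => abs_sub_le_of_deriv_le_inv_sq hL (fun x hx => (hb1 x hx).trans (hpow x hx))
  have hF : ∀ x, 0 ≤ x → HasDerivAt (fun x => x * L' x) (L' x + x * L'' x) x := by
    intro x hx
    exact ((hasDerivAt_id x).mul (hL' x hx)).congr_deriv (by simp)
  have hF' : ∀ x, 0 ≤ x → |L' x + x * L'' x| ≤ C / (1 + x) ^ 2 := by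
    intro x hx
    refine (abs_add_le _ _).trans ?_
    rw [abs_mul, abs_of_nonneg hx]
    calc |L' x| + x * |L'' x| ≤ C / (1 + x) ^ 3 + x * (C / (1 + x) ^ 3) := by
          gcongr
          · exact hb1 x hx
          · exact hb2 x hx
      _ = C / (1 + x) ^ 2 := by field_simp
  have hvarF : ∀ x y, 0 ≤ x → x ≤ y →
      |y * L' y - x * L' x| ≤ C * (1 / (1 + x) - 1 / (1 + y)) :=
    fun x y => abs_sub_le_of_deriv_le_inv_sq hF hF'
  have hinv : ∀ x : ℝ, 0 ≤ x → 0 < 1 / (1 + x) ∧ 1 / (1 + x) ≤ 1 := by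
    intro x hx
    refine ⟨by positivity, ?_⟩
    rw [div_le_one (by positivity)]
    linarith
  have hLb : ∀ x y, 0 ≤ x → 0 ≤ y → |L y - L x| ≤ C := by
    intro x y hx hy
    rcases le_total x y with h | h
    · have := hvarL x y hx h
      nlinarith [hinv x hx, hinv y hy]
    · have := hvarL y x hy h
      rw [abs_sub_comm]
      nlinarith [hinv x hx, hinv y hy]
  have hFb : ∀ x, 0 ≤ x → |x * L' x| ≤ C / (1 + x) := by
    intro x hx
    rw [abs_mul, abs_of_nonneg hx]
    calc x * |L' x| ≤ (1 + x) * (C / (1 + x) ^ 2) := by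
          gcongr
          · linarith
          · exact (hb1 x hx).trans (hpow x hx)
      _ = C / (1 + x) := by field_simp
  have hFC : ∀ x, 0 ≤ x → |x * L' x| ≤ C := by
    intro x hx
    refine (hFb x hx).trans (div_le_self hC (by linarith))
  have hlin : ∀ x, 0 ≤ x → |L x| ≤ C * x := by
    intro x hx
    have := hvarL 0 x le_rfl hx
    rw [hL0, sub_zero] at this
    refine this.trans ?_
    gcongr
    rw [add_zero, div_one, sub_le_iff_le_add, ← sub_le_iff_le_add']
    have hx1 : 0 < 1 + x := by linarith
    rw [le_div_iff₀ hx1]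
    nlinarith
  have hLs : ∀ c : ℕ → ℝ, (∀ n, 0 < c n) → Summable c → ∀ r : ℝ, 0 ≤ r →
      Summable fun n => L (r * c n) := by
    intro c hc hcs r hr
    refine Summable.of_norm_bounded ((hcs.mul_left (C * r))) fun n => ?_
    have := hlin (r * c n) (mul_nonneg hr (hc n).le)
    rw [Real.norm_eq_abs]
    linarith
  -- The first-order Taylor remainder: `r aₙ - r bₙ = -dₙ · r bₙ` explains the plus sign.
  set e : ℝ → ℕ → ℝ :=
    fun r n => L (r * a n) - L (r * b n) + d n * (r * b n * L' (r * b n)) with he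
  have hinv0 : ∀ c : ℝ, 0 < c → Tendsto (fun r : ℝ => C / (1 + r * c)) atTop (𝓝 0) := by
    intro c hc
    apply Tendsto.const_div_atTop
    exact tendsto_atTop_add_const_left _ _ (tendsto_id.atTop_mul_const hc)
  have hF0 : ∀ n, Tendsto (fun r => r * b n * L' (r * b n)) atTop (𝓝 0) := by
    intro n
    refine squeeze_zero_norm' ?_ (hinv0 (b n) (hb_pos n))
    filter_upwards [eventually_ge_atTop 0] with r hr
    exact hFb _ (mul_nonneg hr (hb_pos n).le)
  have hL0' : ∀ n, Tendsto (fun r => L (r * a n) - L (r * b n)) atTop (𝓝 0) := by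
    intro n
    have := (hinv0 (a n) (ha_pos n)).add (hinv0 (b n) (hb_pos n))
    rw [add_zero] at this
    refine squeeze_zero_norm' ?_ this
    filter_upwards [eventually_ge_atTop 0] with r hr
    have h1 : 0 ≤ r * a n := mul_nonneg hr (ha_pos n).le
    have h2 : 0 ≤ r * b n := mul_nonneg hr (hb_pos n).le
    rw [Real.norm_eq_abs]
    have e1 := mul_nonneg hC (hinv _ h1).1.le
    have e2 := mul_nonneg hC (hinv _ h2).1.le
    rcases le_total (r * a n) (r * b n) with h | h
    · have := hvarL _ _ h1 h
      rw [abs_sub_comm]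
      rw [div_eq_mul_one_div C, div_eq_mul_one_div C (1 + r * b n)]
      linarith
    · have := hvarL _ _ h2 h
      rw [div_eq_mul_one_div C, div_eq_mul_one_div C (1 + r * b n)]
      linarith
  -- If `dₙ ≤ 1/2` then `r aₙ ≥ r bₙ/2` and Taylor's formula gives `4C dₙ²`. Otherwise boundedness
  -- of `L` increments and of `F` gives `C(1 + dₙ)`, and `1 + d ≤ 6d²` for `d ≥ 1/2`, with equality
  -- at `1/2`.
  have he_bound : ∀ r, 0 < r → ∀ n, ‖e r n‖ ≤ 6 * C * d n ^ 2 := by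
    intro r hr n
    have h1 : 0 < r * a n := mul_pos hr (ha_pos n)
    have h2 : 0 < r * b n := mul_pos hr (hb_pos n)
    rw [Real.norm_eq_abs]
    by_cases hdn : d n ≤ 1 / 2
    · have := abs_taylor_le_of_second_deriv hL hL' hC hb2 (x := r * b n) (y := r * a n) h2
        (by rw [hd n]; nlinarith)
      have h3 : (r * a n - r * b n) = - (r * b n) * d n := by rw [hd n]; ring
      rw [h3] at this
      have h4 : -(r * b n) * d n / (r * b n) = - d n := by
        rw [neg_mul, neg_div, mul_div_cancel_left₀ _ h2.ne']
      rw [h4] at this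
      have h5 : e r n = L (r * a n) - L (r * b n) - -(r * b n) * d n * L' (r * b n) := by
        simp only [he]; ring
      rw [h5]
      nlinarith [mul_nonneg hC (sq_nonneg (d n))]
    · push Not at hdn
      have t1 := hLb _ _ h2.le h1.le
      have t2 := hFC _ h2.le
      have t3 : |e r n| ≤ C + d n * C := by
        refine (abs_add_le _ _).trans (add_le_add t1 ?_)
        rw [abs_mul, abs_of_pos (by linarith : 0 < d n)]
        exact mul_le_mul_of_nonneg_left t2 (by linarith)
      refine t3.trans ?_
      have : 1 + d n ≤ 6 * d n ^ 2 := by nlinarith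
      nlinarith
  have hes : Summable fun n => 6 * C * d n ^ 2 := hsq.mul_left _
  have he_lim : Tendsto (fun r => ∑' n, e r n) atTop (𝓝 0) := by
    have : Tendsto (fun r => ∑' n, e r n) atTop (𝓝 (∑' n : ℕ, (0 : ℝ))) := by
      refine tendsto_tsum_of_dominated_convergence hes ?_ ?_
      · intro n
        have := (hL0' n).add ((hF0 n).const_mul (d n))
        simpa [he] using this
      · filter_upwards [eventually_gt_atTop 0] with r hr
        exact he_bound r hr
    simpa using this
  obtain ⟨l, hl⟩ := hconv
  -- Since `∑ dₙ` need not converge absolutely, summability is read off from the other three series.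
  have hdF_sum : ∀ r, 0 < r → Summable fun n => d n * (r * b n * L' (r * b n)) := by
    intro r hr
    have h1 : Summable (e r) := Summable.of_norm_bounded hes (he_bound r hr)
    have h2 := (h1.sub (hLs a ha_pos ha r hr.le)).add (hLs b hb_pos hb r hr.le)
    refine h2.congr fun n => ?_
    simp only [he]; ring
  have habel := tendsto_tsum_mul_of_bounded_variation hl
    (f := fun r n => r * b n * L' (r * b n)) (C := C) hF0
    (by
      filter_upwards [eventually_gt_atTop 0] with r hr N
      -- As `b` decreases, the bounds on consecutive increments telescope and the total variation is
      -- at most `C` for every `r`.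
      have hterm : ∀ n, |r * b (n + 1) * L' (r * b (n + 1)) - r * b n * L' (r * b n)| ≤
          C * (1 / (1 + r * b (n + 1))) - C * (1 / (1 + r * b n)) := by
        intro n
        rw [abs_sub_comm, ← mul_sub]
        exact hvarF _ _ (mul_pos hr (hb_pos _)).le
          (mul_le_mul_of_nonneg_left (hb_anti (Nat.le_succ n)) hr.le)
      refine (Finset.sum_le_sum fun n _ => hterm n).trans ?_
      rw [Finset.sum_range_sub (fun n => C * (1 / (1 + r * b n)))]
      have h1 := hinv (r * b N) (mul_pos hr (hb_pos _)).le
      have h2 := hinv (r * b 0) (mul_pos hr (hb_pos _)).le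
      nlinarith)
    (by
      filter_upwards [eventually_gt_atTop 0] with r hr n
      exact hFC _ (mul_pos hr (hb_pos _)).le)
    (by
      filter_upwards [eventually_gt_atTop 0] with r hr
      exact hdF_sum r hr)
  have := he_lim.sub habel
  rw [sub_zero] at this
  refine this.congr' ?_
  filter_upwards [eventually_gt_atTop 0] with r hr
  have h1 : Summable (e r) := Summable.of_norm_bounded hes (he_bound r hr)
  rw [← h1.tsum_sub (hdF_sum r hr),
    ← (hLs a ha_pos ha r hr.le).tsum_sub (hLs b hb_pos hb r hr.le)]
  refine tsum_congr fun n => ?_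
  simp only [he]; ring

/-! ### The standard normal density and distribution function -/

/-- The standard normal density. -/
noncomputable def stdPDF (w : ℝ) : ℝ := gaussianPDFReal 0 1 w

lemma stdPDF_eq (w : ℝ) : stdPDF w = (√(2 * Real.pi))⁻¹ * Real.exp (-(w ^ 2 / 2)) := by
  simp [stdPDF, gaussianPDFReal, neg_div]

lemma stdPDF_pos (w : ℝ) : 0 < stdPDF w := gaussianPDFReal_pos _ _ _ one_ne_zero

lemma stdPDF_neg (w : ℝ) : stdPDF (-w) = stdPDF w := by simp [stdPDF_eq]

lemma continuous_stdPDF : Continuous stdPDF := by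
  simp_rw [funext stdPDF_eq]; fun_prop

@[fun_prop]
lemma measurable_stdPDF : Measurable stdPDF := continuous_stdPDF.measurable

lemma integrable_stdPDF : Integrable stdPDF := integrable_gaussianPDFReal 0 1

lemma integral_stdPDF : ∫ w, stdPDF w = 1 := integral_gaussianPDFReal_eq_one 0 one_ne_zero

lemma inv_sqrt_two_pi_le_one : (√(2 * Real.pi))⁻¹ ≤ 1 := by
  apply inv_le_one_of_one_le₀
  rw [Real.one_le_sqrt]
  linarith [Real.pi_gt_three]

lemma stdPDF_le_exp (w : ℝ) : stdPDF w ≤ Real.exp (-(w ^ 2 / 2)) := by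
  rw [stdPDF_eq]
  exact mul_le_of_le_one_left (Real.exp_pos _).le inv_sqrt_two_pi_le_one

lemma stdPDF_le_one (w : ℝ) : stdPDF w ≤ 1 := by
  refine (stdPDF_le_exp w).trans (Real.exp_le_one_iff.2 ?_)
  have := sq_nonneg w
  linarith

lemma hasDerivAt_stdPDF (w : ℝ) : HasDerivAt stdPDF (-w * stdPDF w) w := by
  rw [funext stdPDF_eq]
  have h1 : HasDerivAt (fun w : ℝ => -(w ^ 2 / 2)) (-w) w :=
    (((hasDerivAt_id w).pow 2).div_const 2).neg.congr_deriv (by simp)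
  exact (h1.exp.const_mul _).congr_deriv (by ring)

lemma abs_stdPDF_sub_le (x y : ℝ) : |stdPDF y - stdPDF x| ≤ |y - x| := by
  have := Convex.norm_image_sub_le_of_norm_hasDerivWithin_le (f := stdPDF)
    (f' := fun w => -w * stdPDF w) (s := Set.univ) (x := x) (y := y) (C := 1)
    (fun w _ => (hasDerivAt_stdPDF w).hasDerivWithinAt)
    (by
      intro w _
      rw [Real.norm_eq_abs, abs_mul, abs_neg, abs_of_pos (stdPDF_pos w)]
      have h1 : |w| ≤ Real.exp (w ^ 2 / 2) := by
        have := Real.add_one_le_exp (w ^ 2 / 2)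
        have h2 : |w| ≤ w ^ 2 / 2 + 1 := by
          nlinarith [sq_abs w, sq_nonneg (|w| - 1)]
        linarith
      calc |w| * stdPDF w ≤ Real.exp (w ^ 2 / 2) * Real.exp (-(w ^ 2 / 2)) := by
            gcongr
            · exact (stdPDF_pos w).le
            · exact stdPDF_le_exp w
        _ = 1 := by rw [← Real.exp_add]; simp) convex_univ trivial trivial
  simpa using this

lemma pow_mul_stdPDF_le {y : ℝ} (hy : 0 ≤ y) : (1 + y) ^ 4 * stdPDF y ≤ 32 := by
  have h0 := stdPDF_le_exp y
  have h1 := Real.quadratic_le_exp_of_nonneg (x := y ^ 2 / 2) (by positivity)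
  -- With `t = y²/2`: `(1+y)⁴ ≤ 4(1+2t)² = 4 + 16t + 16t² ≤ 32(1 + t + t²/2)`.
  have h2 : (1 + y) ^ 4 ≤ 32 * Real.exp (y ^ 2 / 2) := by
    have h3 : (1 + y) ^ 2 ≤ 2 * (1 + y ^ 2) := by nlinarith [sq_nonneg (1 - y)]
    have h4 : (1 + y) ^ 4 ≤ (2 * (1 + y ^ 2)) ^ 2 := by
      calc (1 + y) ^ 4 = ((1 + y) ^ 2) ^ 2 := by ring
        _ ≤ _ := by gcongr
    nlinarith [sq_nonneg y]
  calc (1 + y) ^ 4 * stdPDF y ≤ 32 * Real.exp (y ^ 2 / 2) * Real.exp (-(y ^ 2 / 2)) := by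
        gcongr
        exact (stdPDF_pos y).le
    _ = 32 := by rw [mul_assoc, ← Real.exp_add]; simp

/-- Completing the square: an exponential tilt only translates the Gaussian density. -/
lemma exp_mul_stdPDF (x w : ℝ) :
    Real.exp (x * w) * stdPDF w = Real.exp (x ^ 2 / 2) * stdPDF (w - x) := by
  rw [stdPDF_eq, stdPDF_eq]
  have : Real.exp (x * w) * Real.exp (-(w ^ 2 / 2)) =
      Real.exp (x ^ 2 / 2) * Real.exp (-((w - x) ^ 2 / 2)) := by
    rw [← Real.exp_add, ← Real.exp_add]; ring_nf
  linear_combination (√(2 * Real.pi))⁻¹ * this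

lemma exp_mul_stdPDF_sub (δ x : ℝ) :
    Real.exp (-(2 * δ * x)) * stdPDF (x - δ) = stdPDF (x + δ) := by
  rw [stdPDF_eq, stdPDF_eq, mul_left_comm, ← Real.exp_add]
  ring_nf

/-- The standard normal distribution function. -/
noncomputable def stdCDF (y : ℝ) : ℝ := ∫ w in Set.Iic y, stdPDF w

lemma hasDerivAt_stdCDF (y : ℝ) : HasDerivAt stdCDF (stdPDF y) y := by
  have h : stdCDF = fun y => (∫ w in (0 : ℝ)..y, stdPDF w) + stdCDF 0 := by
    funext y
    rw [← intervalIntegral.integral_Iic_sub_Iic integrable_stdPDF.integrableOn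
      integrable_stdPDF.integrableOn]
    simp [stdCDF]
  rw [h]
  exact (intervalIntegral.integral_hasDerivAt_right
    (integrable_stdPDF.intervalIntegrable)
    (measurable_stdPDF.stronglyMeasurable.stronglyMeasurableAtFilter)
    continuous_stdPDF.continuousAt).add_const _

lemma stdCDF_nonneg (y : ℝ) : 0 ≤ stdCDF y :=
  setIntegral_nonneg measurableSet_Iic fun w _ => (stdPDF_pos w).le

lemma stdCDF_le_one (y : ℝ) : stdCDF y ≤ 1 := by
  rw [← integral_stdPDF]
  exact setIntegral_le_integral integrable_stdPDF (ae_of_all _ fun w => (stdPDF_pos w).le)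

lemma stdCDF_mono : Monotone stdCDF := fun _ _ h =>
  setIntegral_mono_set integrable_stdPDF.integrableOn (ae_of_all _ fun w => (stdPDF_pos w).le)
    (Set.Iic_subset_Iic.2 h).eventuallyLE

lemma setIntegral_Ici_stdPDF (y : ℝ) : ∫ w in Set.Ici (-y), stdPDF w = stdCDF y := by
  rw [integral_Ici_eq_integral_Ioi, stdCDF, ← integral_comp_neg_Iic]
  simp [stdPDF_neg]

lemma half_le_stdCDF {y : ℝ} (hy : 0 ≤ y) : 1 / 2 ≤ stdCDF y := by
  refine le_trans ?_ (stdCDF_mono hy)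
  have h1 := intervalIntegral.integral_Iic_add_Ioi (b := (0 : ℝ)) (f := stdPDF) (μ := volume)
    integrable_stdPDF.integrableOn integrable_stdPDF.integrableOn
  have h2 := setIntegral_Ici_stdPDF 0
  rw [neg_zero, integral_Ici_eq_integral_Ioi] at h2
  rw [h2, integral_stdPDF] at h1
  change stdCDF 0 + stdCDF 0 = 1 at h1
  linarith

/-! ### The tilted folded normal density and its mass -/

/-- The (unnormalised) density of `Y - x` under the exponential tilt of parameter `x`, where
`Y = |N(δ, 1)| - δ`; for `x = 0` it is the density of `Y` itself. -/
noncomputable def foldedDensity (δ x w : ℝ) : ℝ :=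
  Set.indicator (Set.Ici (-δ - x))
    (fun w => stdPDF w + Real.exp (-(2 * δ * x)) * stdPDF (w + 2 * δ)) w

/-- The total mass of `foldedDensity`. -/
noncomputable def foldedMass (δ x : ℝ) : ℝ := ∫ w, foldedDensity δ x w

@[fun_prop]
lemma measurable_foldedDensity (δ x : ℝ) : Measurable (foldedDensity δ x) := by
  unfold foldedDensity
  refine Measurable.indicator ?_ measurableSet_Ici
  fun_prop

lemma foldedDensity_nonneg (δ x w : ℝ) : 0 ≤ foldedDensity δ x w := by
  refine Set.indicator_nonneg (fun w _ => ?_) w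
  have := stdPDF_pos w
  have := stdPDF_pos (w + 2 * δ)
  positivity

lemma exp_neg_two_mul_le_one {δ x : ℝ} (hδ : 0 ≤ δ) (hx : 0 ≤ x) :
    Real.exp (-(2 * δ * x)) ≤ 1 := by
  rw [Real.exp_le_one_iff]
  have := mul_nonneg hδ hx
  linarith

lemma foldedDensity_le {δ x : ℝ} (hδ : 0 ≤ δ) (hx : 0 ≤ x) (w : ℝ) :
    foldedDensity δ x w ≤ stdPDF w + stdPDF (w + 2 * δ) := by
  have h1 := stdPDF_pos w
  have h2 := stdPDF_pos (w + 2 * δ)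
  refine Set.indicator_apply_le' (fun _ => ?_) fun _ => by positivity
  have := exp_neg_two_mul_le_one hδ hx
  nlinarith

lemma foldedDensity_le_two {δ x : ℝ} (hδ : 0 ≤ δ) (hx : 0 ≤ x) (w : ℝ) :
    foldedDensity δ x w ≤ 2 := by
  linarith [foldedDensity_le hδ hx w, stdPDF_le_one w, stdPDF_le_one (w + 2 * δ)]

lemma integrable_stdPDF_add (c : ℝ) : Integrable fun w => stdPDF (w + c) :=
  integrable_stdPDF.comp_add_right c

lemma integrable_foldedDensity (δ x : ℝ) : Integrable (foldedDensity δ x) := by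
  unfold foldedDensity
  exact (integrable_stdPDF.add ((integrable_stdPDF_add (2 * δ)).const_mul _)).indicator
    measurableSet_Ici

/-- The two terms come from the branches `z ≥ 0` and `z < 0` of `|z|`; a shift by `2δ` brings the
second to standard form. -/
lemma foldedMass_eq (δ x : ℝ) :
    foldedMass δ x = stdCDF (x + δ) + Real.exp (-(2 * δ * x)) * stdCDF (x - δ) := by
  unfold foldedMass foldedDensity
  rw [integral_indicator measurableSet_Ici, integral_add integrable_stdPDF.integrableOn
    ((integrable_stdPDF_add (2 * δ)).const_mul _).integrableOn, integral_const_mul]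
  have h1 : ∫ w in Set.Ici (-δ - x), stdPDF w = stdCDF (x + δ) := by
    rw [← setIntegral_Ici_stdPDF]; ring_nf
  have h2 := (measurePreserving_add_right volume (2 * δ)).setIntegral_preimage_emb
    (measurableEmbedding_addRight _) stdPDF (Set.Ici (-(x - δ)))
  rw [Set.preimage_add_const_Ici, setIntegral_Ici_stdPDF] at h2
  rw [h1, ← h2]
  ring_nf

/-- The uniform lower bound makes logarithms and normalisations harmless; each later division by the
mass costs a factor `2`. -/
lemma half_le_foldedMass {δ x : ℝ} (hδ : 0 ≤ δ) (hx : 0 ≤ x) : 1 / 2 ≤ foldedMass δ x := by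
  rw [foldedMass_eq]
  have h1 := half_le_stdCDF (add_nonneg hx hδ)
  have h2 := mul_nonneg (Real.exp_pos (-(2 * δ * x))).le (stdCDF_nonneg (x - δ))
  linarith

lemma foldedMass_pos {δ x : ℝ} (hδ : 0 ≤ δ) (hx : 0 ≤ x) : 0 < foldedMass δ x := by
  linarith [half_le_foldedMass hδ hx]

lemma foldedMass_zero (δ : ℝ) : foldedMass δ 0 = 1 := by
  rw [foldedMass_eq, ← setIntegral_Ici_stdPDF (0 + δ), integral_Ici_eq_integral_Ioi, stdCDF]
  simp only [zero_add, mul_zero, neg_zero, Real.exp_zero, one_mul, zero_sub]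
  rw [add_comm, intervalIntegral.integral_Iic_add_Ioi integrable_stdPDF.integrableOn
    integrable_stdPDF.integrableOn, integral_stdPDF]

/-- The tilted density is close to a multiple of the standard normal density. -/
lemma abs_foldedDensity_sub_le {δ x : ℝ} (hδ : 0 ≤ δ) (hx : 0 < x) (w : ℝ) :
    |foldedDensity δ x w - (1 + Real.exp (-(2 * δ * x))) * stdPDF w| ≤
      1 / x + 2 * Set.indicator (Set.Iio (-δ - x)) 1 w := by
  by_cases hw : -δ - x ≤ w
  · have e1 : foldedDensity δ x w =
        stdPDF w + Real.exp (-(2 * δ * x)) * stdPDF (w + 2 * δ) := by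
      simp [foldedDensity, hw]
    have e2 : Set.indicator (Set.Iio (-δ - x)) (1 : ℝ → ℝ) w = 0 := by simp [hw]
    rw [e1, e2]
    have e3 : stdPDF w + Real.exp (-(2 * δ * x)) * stdPDF (w + 2 * δ) -
        (1 + Real.exp (-(2 * δ * x))) * stdPDF w =
        Real.exp (-(2 * δ * x)) * (stdPDF (w + 2 * δ) - stdPDF w) := by ring
    rw [e3, abs_mul, abs_of_pos (Real.exp_pos _), mul_zero, add_zero, le_div_iff₀ hx]
    have h1 := abs_stdPDF_sub_le w (w + 2 * δ)
    rw [add_sub_cancel_left, abs_of_nonneg (by positivity : 0 ≤ 2 * δ)] at h1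
    -- The inequality `t exp(-t) ≤ 1` at `t = 2δx` yields a bound `1/x` that is uniform in `δ ≥ 0`.
    have h2 := Real.add_one_le_exp (2 * δ * x)
    calc Real.exp (-(2 * δ * x)) * |stdPDF (w + 2 * δ) - stdPDF w| * x
        ≤ Real.exp (-(2 * δ * x)) * (2 * δ) * x := by gcongr
      _ = Real.exp (-(2 * δ * x)) * (2 * δ * x) := by ring
      _ ≤ Real.exp (-(2 * δ * x)) * Real.exp (2 * δ * x) := by gcongr; linarith
      _ = 1 := by rw [← Real.exp_add]; simp
  · have e1 : foldedDensity δ x w = 0 := by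
      simp only [foldedDensity, Set.indicator_apply_eq_zero, Set.mem_Ici]
      exact fun h => absurd h hw
    have e2 : Set.indicator (Set.Iio (-δ - x)) (1 : ℝ → ℝ) w = 1 := by
      simp only [Set.indicator_apply, Set.mem_Iio, Pi.one_apply]
      rw [if_pos (not_le.1 hw)]
    rw [e1, e2, zero_sub, abs_neg, abs_mul, abs_of_pos (stdPDF_pos w), abs_of_pos (by positivity)]
    have h1 := exp_neg_two_mul_le_one hδ hx.le
    have h2 := stdPDF_le_one w
    have h3 := stdPDF_pos w
    have h4 : 0 < 1 / x := by positivity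
    nlinarith

/-- Dominated convergence. The factor `1 + exp(-2δx)` is kept instead of its limit, which is `1` for
`δ > 0` but `2` for `δ = 0`; both cases are then handled at once. -/
lemma tendsto_integral_abs_foldedDensity_sub {δ : ℝ} (hδ : 0 ≤ δ) :
    Tendsto (fun x => ∫ w, |foldedDensity δ x w - (1 + Real.exp (-(2 * δ * x))) * stdPDF w|)
      atTop (𝓝 0) := by
  have : Tendsto (fun x => ∫ w, |foldedDensity δ x w - (1 + Real.exp (-(2 * δ * x))) * stdPDF w|)
      atTop (𝓝 (∫ w : ℝ, (0 : ℝ))) := by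
    refine tendsto_integral_filter_of_dominated_convergence
      (fun w => stdPDF w + stdPDF (w + 2 * δ) + 2 * stdPDF w) ?_ ?_ ?_ ?_
    · filter_upwards with x
      exact Measurable.aestronglyMeasurable (by fun_prop)
    · filter_upwards [eventually_ge_atTop 0] with x hx
      refine ae_of_all _ fun w => ?_
      rw [Real.norm_eq_abs, abs_abs]
      refine (abs_sub _ _).trans ?_
      rw [abs_of_nonneg (foldedDensity_nonneg _ _ _), abs_mul, abs_of_pos (stdPDF_pos w),
        abs_of_pos (by positivity)]
      have h1 := exp_neg_two_mul_le_one hδ hx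
      have h3 := stdPDF_pos w
      have h4 := foldedDensity_le hδ hx w
      nlinarith
    · exact (integrable_stdPDF.add (integrable_stdPDF_add _)).add (integrable_stdPDF.const_mul 2)
    · refine ae_of_all _ fun w => ?_
      refine squeeze_zero' (Eventually.of_forall fun _ => abs_nonneg _) ?_
        (tendsto_inv_atTop_zero)
      filter_upwards [eventually_gt_atTop 0, eventually_ge_atTop (-δ - w)] with x hx hxw
      refine (abs_foldedDensity_sub_le hδ hx w).trans ?_
      have : Set.indicator (Set.Iio (-δ - x)) (1 : ℝ → ℝ) w = 0 := by
        simp only [Set.indicator_apply_eq_zero, Set.mem_Iio]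
        intro h; linarith
      rw [this]; simp
  simpa using this

lemma tendsto_foldedMass_div {δ : ℝ} (hδ : 0 ≤ δ) :
    Tendsto (fun x => (1 + Real.exp (-(2 * δ * x))) / foldedMass δ x) atTop (𝓝 1) := by
  have h1 : Tendsto (fun x => foldedMass δ x - (1 + Real.exp (-(2 * δ * x)))) atTop (𝓝 0) := by
    refine squeeze_zero_norm (fun x => ?_) (tendsto_integral_abs_foldedDensity_sub hδ)
    have : foldedMass δ x - (1 + Real.exp (-(2 * δ * x))) =
        ∫ w, (foldedDensity δ x w - (1 + Real.exp (-(2 * δ * x))) * stdPDF w) := by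
      rw [integral_sub (integrable_foldedDensity _ _) (integrable_stdPDF.const_mul _),
        integral_const_mul, integral_stdPDF, mul_one, foldedMass]
    rw [this]
    exact norm_integral_le_integral_norm _
  have h2 : Tendsto (fun x => 1 - (foldedMass δ x - (1 + Real.exp (-(2 * δ * x)))) /
      foldedMass δ x) atTop (𝓝 (1 - 0)) := by
    refine tendsto_const_nhds.sub ?_
    have h3 := h1.norm.const_mul 2
    rw [norm_zero, mul_zero] at h3
    refine squeeze_zero_norm' ?_ h3
    filter_upwards [eventually_ge_atTop 0] with x hx
    have := half_le_foldedMass hδ hx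
    rw [norm_div, Real.norm_of_nonneg (by linarith : 0 ≤ foldedMass δ x),
      div_le_iff₀ (by linarith)]
    nlinarith [norm_nonneg (foldedMass δ x - (1 + Real.exp (-(2 * δ * x))))]
  rw [sub_zero] at h2
  refine h2.congr' ?_
  filter_upwards [eventually_ge_atTop 0] with x hx
  have := foldedMass_pos hδ hx
  field_simp
  ring

/-! ### Derivative bounds for the logarithm of the mass -/

/-- The cubic term of the exponential series, evaluated at `2δ(1+x)`, gives the decay. The prefactor
`δ` is essential: it covers `δ = 0`, where the exponential does not decay. -/
lemma exists_mul_exp_le_div_pow {δ : ℝ} (hδ : 0 ≤ δ) :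
    ∃ K, 0 ≤ K ∧ ∀ x, 0 ≤ x → δ * Real.exp (-(2 * δ * x)) ≤ K / (1 + x) ^ 3 := by
  rcases hδ.eq_or_lt with rfl | hpos
  · exact ⟨0, le_rfl, by simp⟩
  · refine ⟨δ * (6 * Real.exp (2 * δ) / (2 * δ) ^ 3), by positivity, fun x hx => ?_⟩
    have h := Real.pow_div_factorial_le_exp (2 * δ * (1 + x)) (by positivity) 3
    rw [mul_div_assoc]
    gcongr
    rw [le_div_iff₀ (by positivity), le_div_iff₀ (by positivity)]
    have e : Real.exp (2 * δ * (1 + x)) = Real.exp (2 * δ) * Real.exp (2 * δ * x) := by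
      rw [← Real.exp_add]; ring_nf
    rw [e, div_le_iff₀ (by positivity), mul_pow] at h
    norm_num [Nat.factorial] at h
    calc Real.exp (-(2 * δ * x)) * (1 + x) ^ 3 * (2 * δ) ^ 3
        = Real.exp (-(2 * δ * x)) * ((2 * δ) ^ 3 * (1 + x) ^ 3) := by ring
      _ ≤ Real.exp (-(2 * δ * x)) * (Real.exp (2 * δ) * Real.exp (2 * δ * x) * 6) := by gcongr
      _ = 6 * Real.exp (2 * δ) * (Real.exp (-(2 * δ * x)) * Real.exp (2 * δ * x)) := by ring
      _ = 6 * Real.exp (2 * δ) := by rw [← Real.exp_add]; simp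

/-- The product rule produces `exp(-2δx) φ(x-δ)`, which equals `φ(x+δ)`. Thus every exponential left
in the derivatives of the mass carries a factor `δ`. -/
lemma hasDerivAt_exp_mul_stdCDF (δ x : ℝ) :
    HasDerivAt (fun x => Real.exp (-(2 * δ * x)) * stdCDF (x - δ))
      (-(2 * δ) * (Real.exp (-(2 * δ * x)) * stdCDF (x - δ)) + stdPDF (x + δ)) x := by
  have h1 : HasDerivAt (fun x : ℝ => -(2 * δ * x)) (-(2 * δ)) x :=
    ((hasDerivAt_id x).const_mul (2 * δ)).neg.congr_deriv (by simp)
  have h2 : HasDerivAt (fun x => stdCDF (x - δ)) (stdPDF (x - δ)) x :=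
    (hasDerivAt_stdCDF (x - δ)).comp_sub_const x δ
  refine (h1.exp.mul h2).congr_deriv ?_
  rw [← exp_mul_stdPDF_sub δ x]
  ring

lemma hasDerivAt_foldedMass (δ x : ℝ) :
    HasDerivAt (foldedMass δ)
      (2 * stdPDF (x + δ) - 2 * δ * (Real.exp (-(2 * δ * x)) * stdCDF (x - δ))) x := by
  rw [funext (foldedMass_eq δ)]
  refine (((hasDerivAt_stdCDF (x + δ)).comp_add_const x δ).add
    (hasDerivAt_exp_mul_stdCDF δ x)).congr_deriv ?_
  ring

lemma hasDerivAt_deriv_foldedMass (δ x : ℝ) :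
    HasDerivAt
      (fun x => 2 * stdPDF (x + δ) - 2 * δ * (Real.exp (-(2 * δ * x)) * stdCDF (x - δ)))
      (-2 * ((x + δ) * stdPDF (x + δ)) +
        4 * δ * (δ * (Real.exp (-(2 * δ * x)) * stdCDF (x - δ))) - 2 * δ * stdPDF (x + δ)) x := by
  refine ((((hasDerivAt_stdPDF (x + δ)).comp_add_const x δ).const_mul 2).sub
    ((hasDerivAt_exp_mul_stdCDF δ x).const_mul (2 * δ))).congr_deriv ?_
  ring

/-- The logarithm of `foldedMass` has first two derivatives of order `(1 + x)⁻³`. -/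
lemma exists_log_foldedMass_deriv_bounds {δ : ℝ} (hδ : 0 ≤ δ) :
    ∃ (L' L'' : ℝ → ℝ) (C : ℝ), 0 ≤ C ∧
      (∀ x, 0 ≤ x → HasDerivAt (fun x => Real.log (foldedMass δ x)) (L' x) x) ∧
      (∀ x, 0 ≤ x → HasDerivAt L' (L'' x) x) ∧
      (∀ x, 0 ≤ x → |L' x| ≤ C / (1 + x) ^ 3) ∧
      (∀ x, 0 ≤ x → |L'' x| ≤ C / (1 + x) ^ 3) := by
  obtain ⟨K, hK0, hK⟩ := exists_mul_exp_le_div_pow hδ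
  set h1 : ℝ → ℝ :=
    fun x => 2 * stdPDF (x + δ) - 2 * δ * (Real.exp (-(2 * δ * x)) * stdCDF (x - δ)) with hh1
  set h2 : ℝ → ℝ := fun x => -2 * ((x + δ) * stdPDF (x + δ)) +
        4 * δ * (δ * (Real.exp (-(2 * δ * x)) * stdCDF (x - δ))) - 2 * δ * stdPDF (x + δ) with hh2
  have hφ : ∀ x, 0 ≤ x → (1 + (x + δ)) * stdPDF (x + δ) ≤ 32 / (1 + x) ^ 3 := by
    intro x hx
    rw [le_div_iff₀ (by positivity)]
    refine le_trans ?_ (pow_mul_stdPDF_le (add_nonneg hx hδ))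
    have h3 : (1 + x) ^ 3 ≤ (1 + (x + δ)) ^ 3 := by gcongr; linarith
    have h4 : 0 ≤ (1 + (x + δ)) * stdPDF (x + δ) := by
      have := stdPDF_pos (x + δ); positivity
    calc (1 + (x + δ)) * stdPDF (x + δ) * (1 + x) ^ 3
        ≤ (1 + (x + δ)) * stdPDF (x + δ) * (1 + (x + δ)) ^ 3 := by gcongr
      _ = _ := by ring
  have hE : ∀ x, 0 ≤ x → 0 ≤ δ * (Real.exp (-(2 * δ * x)) * stdCDF (x - δ)) ∧
      δ * (Real.exp (-(2 * δ * x)) * stdCDF (x - δ)) ≤ K / (1 + x) ^ 3 := by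
    intro x hx
    have e0 := stdCDF_nonneg (x - δ)
    refine ⟨by positivity, le_trans ?_ (hK x hx)⟩
    gcongr
    exact mul_le_of_le_one_right (Real.exp_pos _).le (stdCDF_le_one _)
  -- One constant for both derivatives of the mass: `64` and `64δ` come from the Gaussian terms
  -- through `hφ`, `2K` and `4δK` from the exponential terms through `hE`.
  set M := 64 + 2 * K + 4 * δ * K + 64 * δ with hM
  have hM0 : 0 ≤ M := by positivity
  have hb1 : ∀ x, 0 ≤ x → |h1 x| ≤ M / (1 + x) ^ 3 := by
    intro x hx
    obtain ⟨e1, e2⟩ := hE x hx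
    have e3 := hφ x hx
    have e4 := stdPDF_pos (x + δ)
    have e5 : 0 ≤ (x + δ) * stdPDF (x + δ) := by positivity
    have e6 : M / (1 + x) ^ 3 = 2 * (32 / (1 + x) ^ 3) + 2 * (K / (1 + x) ^ 3) +
      4 * δ * (K / (1 + x) ^ 3) + 2 * δ * (32 / (1 + x) ^ 3) := by rw [hM]; ring
    have e7 : 0 ≤ 4 * δ * (K / (1 + x) ^ 3) := by positivity
    have e8 : 0 ≤ 2 * δ * (32 / (1 + x) ^ 3) := by positivity
    rw [e6, abs_le]
    simp only [hh1]
    constructor <;> nlinarith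
  have hb2 : ∀ x, 0 ≤ x → |h2 x| ≤ M / (1 + x) ^ 3 := by
    intro x hx
    obtain ⟨e1, e2⟩ := hE x hx
    have e3 := hφ x hx
    have e4 := stdPDF_pos (x + δ)
    have e5 : 0 ≤ (x + δ) * stdPDF (x + δ) := by positivity
    have e6 : M / (1 + x) ^ 3 = 2 * (32 / (1 + x) ^ 3) + 2 * (K / (1 + x) ^ 3) +
      4 * δ * (K / (1 + x) ^ 3) + 2 * δ * (32 / (1 + x) ^ 3) := by rw [hM]; ring
    have e7 := mul_le_mul_of_nonneg_left e2 (by positivity : 0 ≤ 4 * δ)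
    have e7' : 0 ≤ 4 * δ * (δ * (Real.exp (-(2 * δ * x)) * stdCDF (x - δ))) :=
      mul_nonneg (by positivity) e1
    have e8 : 2 * δ * stdPDF (x + δ) ≤ 2 * δ * (32 / (1 + x) ^ 3) := by
      gcongr
      linarith
    have e8' : 0 ≤ 2 * δ * stdPDF (x + δ) := by positivity
    have e9 : 0 ≤ K / (1 + x) ^ 3 := by positivity
    rw [e6, abs_le]
    simp only [hh2]
    constructor <;> linarith
  -- For the mass `m`, `L' = m'/m` and `L'' = m''/m - (m'/m)²`. Since `m ≥ 1/2`, the quotients are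
  -- bounded by `2M/(1+x)³`; in the square one such power is simply dropped, leaving `4M²`.
  refine ⟨fun x => h1 x / foldedMass δ x,
    fun x => (h2 x * foldedMass δ x - h1 x * h1 x) / foldedMass δ x ^ 2, 2 * M + 4 * M ^ 2,
    by positivity, fun x hx => ?_, fun x hx => ?_, fun x hx => ?_, fun x hx => ?_⟩
  · exact (hasDerivAt_foldedMass δ x).log (foldedMass_pos hδ hx).ne'
  · exact (hasDerivAt_deriv_foldedMass δ x).div (hasDerivAt_foldedMass δ x)
      (foldedMass_pos hδ hx).ne'
  · have hm := half_le_foldedMass hδ hx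
    have hm0 := foldedMass_pos hδ hx
    rw [abs_div, abs_of_pos hm0, div_le_iff₀ hm0]
    refine (hb1 x hx).trans ?_
    have e : (2 * M + 4 * M ^ 2) / (1 + x) ^ 3 = 2 * (M / (1 + x) ^ 3) + 4 * M ^ 2 / (1 + x) ^ 3 :=
      by ring
    have e1 : 0 ≤ M / (1 + x) ^ 3 := by positivity
    have e2 : 0 ≤ 4 * M ^ 2 / (1 + x) ^ 3 := by positivity
    rw [e]
    nlinarith
  · have hm := half_le_foldedMass hδ hx
    have hm0 := foldedMass_pos hδ hx
    have e0 : (h2 x * foldedMass δ x - h1 x * h1 x) / foldedMass δ x ^ 2 =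
        h2 x / foldedMass δ x - (h1 x / foldedMass δ x) * (h1 x / foldedMass δ x) := by
      field_simp
    have hq : ∀ y B : ℝ, |y| ≤ B → |y / foldedMass δ x| ≤ 2 * B := by
      intro y B hy
      rw [abs_div, abs_of_pos hm0, div_le_iff₀ hm0]
      nlinarith [abs_nonneg y]
    have f1 := hq _ _ (hb1 x hx)
    have f2 := hq _ _ (hb2 x hx)
    simp only [e0]
    refine (abs_sub _ _).trans ?_
    rw [abs_mul]
    have f3 : |h1 x / foldedMass δ x| * |h1 x / foldedMass δ x| ≤ 4 * M ^ 2 / (1 + x) ^ 3 := by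
      calc |h1 x / foldedMass δ x| * |h1 x / foldedMass δ x|
          ≤ (2 * (M / (1 + x) ^ 3)) * (2 * (M / (1 + x) ^ 3)) := by gcongr
        _ ≤ (2 * (M / (1 + x) ^ 3)) * (2 * M) := by
            gcongr
            exact div_le_self hM0 (one_le_pow₀ (by linarith))
        _ = _ := by ring
    have : (2 * M + 4 * M ^ 2) / (1 + x) ^ 3 = 2 * (M / (1 + x) ^ 3) + 4 * M ^ 2 / (1 + x) ^ 3 := by
      ring
    linarith

/-! ### The law of `|N(δ,1)| - δ` and its Laplace and Fourier transforms -/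

/-- The law of `|N(δ, 1)| - δ`. -/
noncomputable def foldedLaw (δ : ℝ) : Measure ℝ :=
  volume.withDensity fun w => ENNReal.ofReal (foldedDensity δ 0 w)

lemma gaussianReal_map_abs_sub (δ : ℝ) :
    (gaussianReal δ 1).map (fun z => |z| - δ) = foldedLaw δ := by
  refine Measure.ext_of_lintegral _ fun f hf => ?_
  have hm : Measurable fun z : ℝ => |z| - δ := by fun_prop
  rw [lintegral_map hf hm, gaussianReal_of_var_ne_zero _ one_ne_zero,
    lintegral_withDensity_eq_lintegral_mul _ (measurable_gaussianPDF _ _)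
      (show Measurable fun z => f (|z| - δ) from hf.comp hm),
    foldedLaw, lintegral_withDensity_eq_lintegral_mul _ (by fun_prop) hf]
  set g₁ : ℝ → ENNReal :=
    Set.indicator (Set.Ici (-δ)) (fun w => ENNReal.ofReal (stdPDF w) * f w) with hg₁
  -- The negative branch lives on the open half-line, so that `z = 0` is counted once; this differs
  -- from the folded density only at the null point `-δ`.
  set g₂ : ℝ → ENNReal :=
    Set.indicator (Set.Ioi (-δ)) (fun w => ENNReal.ofReal (stdPDF (w + 2 * δ)) * f w) with hg₂
  have hg₁m : Measurable g₁ := Measurable.indicator (by fun_prop) measurableSet_Ici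
  have hg₂m : Measurable g₂ := Measurable.indicator (by fun_prop) measurableSet_Ioi
  have hpdf : ∀ z, gaussianPDF δ 1 z = ENNReal.ofReal (stdPDF (z - δ)) := by
    intro z
    rw [gaussianPDF, stdPDF, gaussianPDFReal_sub, zero_add]
  have e1 : ∀ z, (gaussianPDF δ 1 * fun z => f (|z| - δ)) z = g₁ (z - δ) + g₂ (-z - δ) := by
    intro z
    simp only [Pi.mul_apply, hpdf, hg₁, hg₂, Set.indicator_apply, Set.mem_Ici,
      Set.mem_Ioi]
    rcases le_or_gt 0 z with h | h
    · rw [if_pos (by linarith), if_neg (by linarith), abs_of_nonneg h, add_zero]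
    · rw [if_neg (by linarith), if_pos (by linarith), abs_of_neg h, zero_add]
      congr 2
      rw [← stdPDF_neg]; ring_nf
  have e2 : (fun w => ((fun w => ENNReal.ofReal (foldedDensity δ 0 w)) * f) w) =ᵐ[volume]
      fun w => g₁ w + g₂ w := by
    filter_upwards [Measure.ae_ne volume (-δ)] with w hw
    simp only [Pi.mul_apply, hg₁, hg₂, Set.indicator_apply, Set.mem_Ici,
      Set.mem_Ioi, foldedDensity, sub_zero, mul_zero, neg_zero, Real.exp_zero, one_mul]
    rcases lt_or_ge w (-δ) with h | h
    · rw [if_neg (by linarith), if_neg (by linarith), if_neg (by linarith)]; simp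
    · rw [if_pos h, if_pos h, if_pos (lt_of_le_of_ne h (Ne.symm hw)),
        ENNReal.ofReal_add (stdPDF_pos _).le (stdPDF_pos _).le, add_mul]
  rw [lintegral_congr_ae e2, lintegral_congr e1, lintegral_add_left hg₁m,
    lintegral_add_left (show Measurable fun z => g₁ (z - δ) by fun_prop),
    lintegral_sub_right_eq_self (μ := volume) g₁ δ]
  congr 1
  have := lintegral_neg_eq_self (μ := (volume : Measure ℝ)) (fun z => g₂ (z - δ))
  rw [this, lintegral_sub_right_eq_self (μ := volume) g₂ δ]

lemma hasLaw_abs_div_sub {Ω : Type*} [MeasurableSpace Ω] {P : Measure Ω} {Z : Ω → ℝ} {α β : ℝ}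
    (hβ : 0 < β) (hZ : HasLaw Z (gaussianReal α (Real.toNNReal (β ^ 2))) P) :
    HasLaw (fun ω => |Z ω| / β - |α| / β) (foldedLaw (|α| / β)) P := by
  have h1 := gaussianReal_div_const hZ β
  have h2 : HasLaw (fun ω => Z ω / β) (gaussianReal (α / β) 1) P := by
    convert h1 using 2
    apply NNReal.eq
    simp [Real.coe_toNNReal _ (sq_nonneg β), hβ.ne']
  -- Only `|Z|` matters, so `Z` may be replaced by `-Z` to make the mean nonnegative.
  obtain ⟨U, hU, hUZ⟩ : ∃ U : Ω → ℝ, HasLaw U (gaussianReal (|α| / β) 1) P ∧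
      ∀ ω, |U ω| = |Z ω| / β := by
    rcases le_total 0 α with h | h
    · refine ⟨_, by rw [abs_of_nonneg h]; exact h2, fun ω => ?_⟩
      rw [abs_div, abs_of_pos hβ]
    · refine ⟨_, by rw [abs_of_nonpos h, neg_div]; exact gaussianReal_neg h2, fun ω => ?_⟩
      simp [abs_div, abs_of_pos hβ]
  refine ⟨?_, ?_⟩
  · have := hZ.aemeasurable
    fun_prop
  · rw [← gaussianReal_map_abs_sub, ← hU.map_eq, AEMeasurable.map_map_of_aemeasurable
      (by fun_prop) hU.aemeasurable]
    congr 1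
    funext ω
    simp [hUZ]

lemma integral_foldedLaw {E : Type*} [NormedAddCommGroup E] [NormedSpace ℝ E] (δ : ℝ) (F : ℝ → E) :
    ∫ w, F w ∂foldedLaw δ = ∫ w, foldedDensity δ 0 w • F w := by
  rw [foldedLaw, integral_withDensity_eq_integral_toReal_smul (by fun_prop) (by simp)]
  simp_rw [ENNReal.toReal_ofReal (foldedDensity_nonneg _ _ _)]

lemma integrable_foldedLaw_iff {E : Type*} [NormedAddCommGroup E] [NormedSpace ℝ E] (δ : ℝ)
    (F : ℝ → E) :
    Integrable F (foldedLaw δ) ↔ Integrable fun w => foldedDensity δ 0 w • F w := by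
  rw [foldedLaw, integrable_withDensity_iff_integrable_smul' (by fun_prop) (by simp)]
  simp_rw [ENNReal.toReal_ofReal (foldedDensity_nonneg _ _ _)]

lemma ae_neg_le_foldedLaw (δ : ℝ) : ∀ᵐ w ∂foldedLaw δ, -δ ≤ w := by
  rw [foldedLaw, ae_withDensity_iff (by fun_prop)]
  refine ae_of_all _ fun w hw => ?_
  by_contra h
  apply hw
  simp [foldedDensity, h]

/-- Completing the square in both branches at once. This one identity yields the real and the
complex moment generating function and the conditional tail. -/
lemma foldedDensity_zero_eq (δ x w : ℝ) :
    foldedDensity δ 0 w =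
      Real.exp (x ^ 2 / 2) * Real.exp (-(x * w)) * foldedDensity δ x (w - x) := by
  have hmul : Real.exp (x * w) * foldedDensity δ 0 w =
      Real.exp (x ^ 2 / 2) * foldedDensity δ x (w - x) := by
    simp only [foldedDensity, Set.indicator_apply, Set.mem_Ici, sub_zero, mul_zero, neg_zero,
      Real.exp_zero, one_mul]
    by_cases h : -δ ≤ w
    · rw [if_pos h, if_pos (by linarith), mul_add, exp_mul_stdPDF, mul_add]
      have h1 := exp_mul_stdPDF x (w + 2 * δ)
      have h2 : Real.exp (x * (w + 2 * δ)) = Real.exp (x * w) * Real.exp (2 * δ * x) := by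
        rw [← Real.exp_add]; ring_nf
      have h3 : Real.exp (2 * δ * x) * Real.exp (-(2 * δ * x)) = 1 := by
        rw [← Real.exp_add]; simp
      have h4 : w - x + 2 * δ = w + 2 * δ - x := by ring
      rw [h2] at h1
      rw [h4]
      linear_combination Real.exp (-(2 * δ * x)) * h1 -
        (Real.exp (x * w) * stdPDF (w + 2 * δ)) * h3
    · rw [if_neg h, if_neg (by intro h'; apply h; linarith)]; simp
  have h3 : Real.exp (-(x * w)) * Real.exp (x * w) = 1 := by rw [← Real.exp_add]; simp
  linear_combination (Real.exp (-(x * w))) * hmul - foldedDensity δ 0 w * h3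

/-- The Fourier transform of `foldedDensity`. -/
noncomputable def foldedChar (δ x s : ℝ) : ℂ :=
  ∫ w, foldedDensity δ x w • Complex.exp (Complex.I * (s * w : ℝ))

lemma integrable_foldedDensity_smul (δ x s : ℝ) :
    Integrable fun w => foldedDensity δ x w • Complex.exp (Complex.I * (s * w : ℝ)) := by
  refine (integrable_foldedDensity δ x).mono' (Measurable.aestronglyMeasurable (by fun_prop)) ?_
  refine ae_of_all _ fun w => ?_
  rw [norm_smul, Complex.norm_exp_I_mul_ofReal, mul_one,
    Real.norm_of_nonneg (foldedDensity_nonneg _ _ _)]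

lemma integral_cexp_foldedLaw (δ x s : ℝ) :
    ∫ w, Complex.exp ((x + s * Complex.I) * w) ∂foldedLaw δ =
      Complex.exp ((x ^ 2 / 2 : ℝ)) * Complex.exp (Complex.I * (s * x : ℝ)) * foldedChar δ x s := by
  rw [integral_foldedLaw]
  have : ∀ w : ℝ, foldedDensity δ 0 w • Complex.exp ((x + s * Complex.I) * w) =
      (fun w : ℝ => Complex.exp ((x ^ 2 / 2 : ℝ)) * Complex.exp (Complex.I * (s * x : ℝ)) *
        (foldedDensity δ x w • Complex.exp (Complex.I * (s * w : ℝ)))) (w - x) := by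
    intro w
    rw [foldedDensity_zero_eq δ x w]
    simp only [Complex.real_smul]
    push_cast
    have h1 : Complex.exp (-(x * w)) * Complex.exp ((x + s * Complex.I) * w) =
        Complex.exp (Complex.I * (s * x)) * Complex.exp (Complex.I * (s * (w - x))) := by
      rw [← Complex.exp_add, ← Complex.exp_add]
      ring_nf
    linear_combination Complex.exp (x ^ 2 / 2) * (foldedDensity δ x (w - x) : ℂ) * h1
  simp_rw [this]
  rw [integral_sub_right_eq_self (μ := volume) (fun w : ℝ => Complex.exp ((x ^ 2 / 2 : ℝ)) *
    Complex.exp (Complex.I * (s * x : ℝ)) *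
        (foldedDensity δ x w • Complex.exp (Complex.I * (s * w : ℝ)))) x, integral_const_mul]
  rfl

lemma smul_exp_foldedDensity (δ x w : ℝ) : foldedDensity δ 0 w • Real.exp (x * w) =
      (fun w : ℝ => Real.exp (x ^ 2 / 2) * foldedDensity δ x w) (w - x) := by
  rw [foldedDensity_zero_eq δ x w, smul_eq_mul]
  have h3 : Real.exp (-(x * w)) * Real.exp (x * w) = 1 := by rw [← Real.exp_add]; simp
  linear_combination Real.exp (x ^ 2 / 2) * foldedDensity δ x (w - x) * h3

lemma integral_exp_foldedLaw (δ x : ℝ) :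
    ∫ w, Real.exp (x * w) ∂foldedLaw δ = Real.exp (x ^ 2 / 2) * foldedMass δ x := by
  rw [integral_foldedLaw]
  simp_rw [smul_exp_foldedDensity]
  rw [integral_sub_right_eq_self (μ := volume)
    (fun w : ℝ => Real.exp (x ^ 2 / 2) * foldedDensity δ x w) x, integral_const_mul]
  rfl

lemma integral_stdPDF_smul_cexp (s : ℝ) :
    ∫ w, stdPDF w • Complex.exp (Complex.I * (s * w : ℝ)) = (Real.exp (-(s ^ 2 / 2)) : ℂ) := by
  have h := charFun_gaussianReal (μ := 0) (v := 1) s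
  rw [charFun_apply_real, integral_gaussianReal_eq_integral_smul one_ne_zero] at h
  rw [Complex.ofReal_exp]
  convert h using 1
  · refine integral_congr_ae (ae_of_all _ fun w => ?_)
    simp only [stdPDF]
    congr 2
    push_cast
    ring
  · congr 1
    push_cast
    ring

lemma foldedChar_sub (δ x s : ℝ) :
    foldedChar δ x s - foldedMass δ x * (Real.exp (-(s ^ 2 / 2)) : ℂ) =
      ∫ w, foldedDensity δ x w •
        (Complex.exp (Complex.I * (s * w : ℝ)) - (Real.exp (-(s ^ 2 / 2)) : ℂ)) := by
  simp_rw [smul_sub]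
  rw [integral_sub (integrable_foldedDensity_smul δ x s)
    ((integrable_foldedDensity δ x).smul_const _), integral_smul_const]
  simp [foldedChar, foldedMass]

lemma norm_cexp_sub_exp_le_two (s w : ℝ) :
    ‖Complex.exp (Complex.I * (s * w : ℝ)) - (Real.exp (-(s ^ 2 / 2)) : ℂ)‖ ≤ 2 := by
  refine (norm_sub_le _ _).trans ?_
  rw [Complex.norm_exp_I_mul_ofReal, Complex.norm_real, Real.norm_of_nonneg (Real.exp_pos _).le]
  have : Real.exp (-(s ^ 2 / 2)) ≤ 1 := Real.exp_le_one_iff.2 (by nlinarith [sq_nonneg s])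
  linarith

lemma norm_cexp_sub_exp_le (s w : ℝ) :
    ‖Complex.exp (Complex.I * (s * w : ℝ)) - (Real.exp (-(s ^ 2 / 2)) : ℂ)‖ ≤
      |s| * (|w| + 1) := by
  have h1 : ‖Complex.exp (Complex.I * (s * w : ℝ)) - 1‖ ≤ |s| * |w| := by
    rw [← abs_mul]
    exact Real.norm_exp_I_mul_ofReal_sub_one_le
  have h2 : ‖(1 : ℂ) - (Real.exp (-(s ^ 2 / 2)) : ℂ)‖ ≤ |s| := by
    rw [← Complex.ofReal_one, ← Complex.ofReal_sub, Complex.norm_real, Real.norm_eq_abs]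
    have h3 : Real.exp (-(s ^ 2 / 2)) ≤ 1 := Real.exp_le_one_iff.2 (by nlinarith [sq_nonneg s])
    have h4 := Real.add_one_le_exp (-(s ^ 2 / 2))
    have h5 := Real.exp_pos (-(s ^ 2 / 2))
    rw [abs_of_nonneg (by linarith)]
    rcases le_total |s| 1 with h | h
    · nlinarith [sq_abs s, abs_nonneg s]
    · linarith
  have h3 := norm_add_le (Complex.exp (Complex.I * (s * w : ℝ)) - 1)
    ((1 : ℂ) - (Real.exp (-(s ^ 2 / 2)) : ℂ))
  rw [sub_add_sub_cancel] at h3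
  linarith

lemma norm_foldedChar_div_sub (δ x s : ℝ) (h : 0 < foldedMass δ x) :
    ‖foldedChar δ x s / foldedMass δ x - (Real.exp (-(s ^ 2 / 2)) : ℂ)‖ =
      ‖foldedChar δ x s - foldedMass δ x * (Real.exp (-(s ^ 2 / 2)) : ℂ)‖ / foldedMass δ x := by
  have h' : (foldedMass δ x : ℂ) ≠ 0 := by exact_mod_cast h.ne'
  rw [div_sub' h', norm_div, Complex.norm_real, Real.norm_of_nonneg h.le]

lemma integrable_abs_mul_stdPDF_add (c : ℝ) : Integrable fun w => |w| * stdPDF (w + c) := by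
  have h1 : Integrable (fun w : ℝ => w * stdPDF w) := by
    simp_rw [stdPDF_eq]
    have := (integrable_mul_exp_neg_mul_sq (b := 1 / 2) (by norm_num)).const_mul
      (√(2 * Real.pi))⁻¹
    refine this.congr (ae_of_all _ fun w => ?_)
    simp only
    ring_nf
  have h2 := ((h1.comp_add_right c).norm.add ((integrable_stdPDF_add c).const_mul |c|))
  refine h2.mono' (Measurable.aestronglyMeasurable (by fun_prop)) (ae_of_all _ fun w => ?_)
  have h3 := stdPDF_pos (w + c)
  simp only [Pi.add_apply, norm_mul, Real.norm_eq_abs, abs_abs, abs_of_pos h3]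
  rw [← add_mul]
  gcongr
  have := abs_sub (w + c) c
  rwa [add_sub_cancel_right] at this

lemma integrable_id_foldedLaw (δ : ℝ) (hδ : 0 ≤ δ) : Integrable (fun w => w) (foldedLaw δ) := by
  rw [integrable_foldedLaw_iff]
  have h := (integrable_abs_mul_stdPDF_add 0).add (integrable_abs_mul_stdPDF_add (2 * δ))
  refine h.mono' (Measurable.aestronglyMeasurable (by fun_prop)) (ae_of_all _ fun w => ?_)
  rw [norm_smul, Real.norm_of_nonneg (foldedDensity_nonneg _ _ _), Real.norm_eq_abs]
  have := mul_le_mul_of_nonneg_right (foldedDensity_le hδ le_rfl w) (abs_nonneg w)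
  simp only [Pi.add_apply, add_zero]
  linarith

/-- Uniform Lipschitz-type bound for the characteristic functions of the tilted laws. -/
lemma exists_norm_foldedChar_div_sub_le {δ : ℝ} (hδ : 0 ≤ δ) :
    ∃ C, 0 ≤ C ∧ ∀ x s, 0 ≤ x →
      ‖foldedChar δ x s / foldedMass δ x - (Real.exp (-(s ^ 2 / 2)) : ℂ)‖ ≤ C * |s| := by
  have hint : Integrable fun w => (|w| + 1) * (stdPDF w + stdPDF (w + 2 * δ)) := by
    have h := ((integrable_abs_mul_stdPDF_add 0).add (integrable_abs_mul_stdPDF_add (2 * δ))).add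
      (integrable_stdPDF.add (integrable_stdPDF_add (2 * δ)))
    refine h.congr (ae_of_all _ fun w => ?_)
    simp only [Pi.add_apply, add_zero]
    ring
  have hnn : 0 ≤ ∫ w, (|w| + 1) * (stdPDF w + stdPDF (w + 2 * δ)) := by
    refine integral_nonneg fun w => ?_
    have := stdPDF_pos w
    have := stdPDF_pos (w + 2 * δ)
    simp only [Pi.zero_apply]
    positivity
  refine ⟨2 * ∫ w, (|w| + 1) * (stdPDF w + stdPDF (w + 2 * δ)), by positivity, fun x s hx => ?_⟩
  have hm := half_le_foldedMass hδ hx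
  have hm0 := foldedMass_pos hδ hx
  rw [norm_foldedChar_div_sub δ x s hm0, foldedChar_sub, div_le_iff₀ hm0]
  have h1 : ‖∫ w, foldedDensity δ x w •
        (Complex.exp (Complex.I * (s * w : ℝ)) - (Real.exp (-(s ^ 2 / 2)) : ℂ))‖ ≤
      ∫ w, |s| * ((|w| + 1) * (stdPDF w + stdPDF (w + 2 * δ))) := by
    refine norm_integral_le_of_norm_le (hint.const_mul _) (ae_of_all _ fun w => ?_)
    rw [norm_smul, Real.norm_of_nonneg (foldedDensity_nonneg _ _ _)]
    calc foldedDensity δ x w * _ ≤ (stdPDF w + stdPDF (w + 2 * δ)) * (|s| * (|w| + 1)) :=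
          mul_le_mul (foldedDensity_le hδ hx w) (norm_cexp_sub_exp_le s w) (norm_nonneg _)
            (add_pos (stdPDF_pos _) (stdPDF_pos _)).le
      _ = _ := by ring
  rw [integral_const_mul] at h1
  refine h1.trans ?_
  have := mul_nonneg hnn (abs_nonneg s)
  nlinarith

/-- The L¹ convergence of the densities passes to Fourier transforms. The factor `4` is `2` from the
bounded integrand times `2` from dividing by the mass. -/
lemma tendsto_norm_foldedChar_div_sub {δ : ℝ} (hδ : 0 ≤ δ) (s : ℝ) :
    Tendsto (fun x => ‖foldedChar δ x s / foldedMass δ x - (Real.exp (-(s ^ 2 / 2)) : ℂ)‖)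
      atTop (𝓝 0) := by
  have h := (tendsto_integral_abs_foldedDensity_sub hδ).const_mul 4
  rw [mul_zero] at h
  refine squeeze_zero' (Eventually.of_forall fun _ => norm_nonneg _) ?_ h
  filter_upwards [eventually_ge_atTop 0] with x hx
  have hm := half_le_foldedMass hδ hx
  have hm0 := foldedMass_pos hδ hx
  rw [norm_foldedChar_div_sub δ x s hm0, foldedChar_sub, div_le_iff₀ hm0]
  set c := 1 + Real.exp (-(2 * δ * x)) with hc
  have hI0 : Integrable fun w => stdPDF w • Complex.exp (Complex.I * (s * w : ℝ)) := by
    refine integrable_stdPDF.mono' (Measurable.aestronglyMeasurable (by fun_prop)) ?_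
    refine ae_of_all _ fun w => ?_
    rw [norm_smul, Complex.norm_exp_I_mul_ofReal, mul_one, Real.norm_of_nonneg (stdPDF_pos _).le]
  have hI : Integrable fun w => stdPDF w •
        (Complex.exp (Complex.I * (s * w : ℝ)) - (Real.exp (-(s ^ 2 / 2)) : ℂ)) := by
    simp_rw [smul_sub]
    exact hI0.sub (integrable_stdPDF.smul_const _)
  have hz : ∫ w, stdPDF w •
        (Complex.exp (Complex.I * (s * w : ℝ)) - (Real.exp (-(s ^ 2 / 2)) : ℂ)) = 0 := by
    simp_rw [smul_sub]
    rw [integral_sub hI0 (integrable_stdPDF.smul_const _), integral_stdPDF_smul_cexp,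
      integral_smul_const, integral_stdPDF, one_smul, sub_self]
  have hJ : Integrable fun w => foldedDensity δ x w •
        (Complex.exp (Complex.I * (s * w : ℝ)) - (Real.exp (-(s ^ 2 / 2)) : ℂ)) := by
    simp_rw [smul_sub]
    exact (integrable_foldedDensity_smul δ x s).sub ((integrable_foldedDensity δ x).smul_const _)
  -- By `hz` the normal density integrates this integrand to zero, so any multiple of it may be
  -- subtracted.
  have hK : ∫ w, foldedDensity δ x w •
        (Complex.exp (Complex.I * (s * w : ℝ)) - (Real.exp (-(s ^ 2 / 2)) : ℂ)) =
      ∫ w, (foldedDensity δ x w - c * stdPDF w) •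
        (Complex.exp (Complex.I * (s * w : ℝ)) - (Real.exp (-(s ^ 2 / 2)) : ℂ)) := by
    simp_rw [sub_smul, mul_smul]
    rw [integral_sub hJ (show Integrable (fun w => c • stdPDF w • _) from hI.smul c), integral_smul, hz, smul_zero, sub_zero]
  have hint : Integrable fun w => |foldedDensity δ x w - c * stdPDF w| :=
    ((integrable_foldedDensity δ x).sub (integrable_stdPDF.const_mul c)).abs
  rw [hK]
  have h1 : ‖∫ w, (foldedDensity δ x w - c * stdPDF w) •
        (Complex.exp (Complex.I * (s * w : ℝ)) - (Real.exp (-(s ^ 2 / 2)) : ℂ))‖ ≤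
      ∫ w, |foldedDensity δ x w - c * stdPDF w| * 2 := by
    refine norm_integral_le_of_norm_le (hint.mul_const _) (ae_of_all _ fun w => ?_)
    rw [norm_smul, Real.norm_eq_abs]
    exact mul_le_mul_of_nonneg_left (norm_cexp_sub_exp_le_two s w) (abs_nonneg _)
  rw [integral_mul_const] at h1
  have h2 : 0 ≤ ∫ w, |foldedDensity δ x w - c * stdPDF w| := integral_nonneg fun w => abs_nonneg _
  nlinarith

/-! ### Weighted sums: convergence, moment generating function, tilted characteristic function -/

lemma ae_summable_mul_of_lintegral_le {Ω : Type*} [MeasurableSpace Ω] {P : Measure Ω}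
    {X : ℕ → Ω → ℝ} (hX : ∀ n, AEMeasurable (X n) P) {M : ENNReal} (hM : M ≠ ⊤)
    (hXM : ∀ n, ∫⁻ ω, ‖X n ω‖ₑ ∂P ≤ M) {a : ℕ → ℝ} (ha : Summable a) (ha0 : ∀ n, 0 ≤ a n) :
    ∀ᵐ ω ∂P, Summable fun n => a n * X n ω := by
  have h1 : ∫⁻ ω, ∑' n, ‖a n * X n ω‖ₑ ∂P ≠ ⊤ := by
    rw [lintegral_tsum (fun n => ((hX n).const_mul (a n)).enorm)]
    have h2 : ∀ n, ∫⁻ ω, ‖a n * X n ω‖ₑ ∂P ≤ ENNReal.ofReal (a n) * M := by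
      intro n
      simp_rw [enorm_mul]
      rw [lintegral_const_mul'' _ (hX n).enorm, Real.enorm_of_nonneg (ha0 n)]
      gcongr
      exact hXM n
    refine ne_top_of_le_ne_top ?_ (ENNReal.tsum_le_tsum h2)
    rw [ENNReal.tsum_mul_right, ← ENNReal.ofReal_tsum_of_nonneg ha0 ha]
    exact ENNReal.mul_ne_top ENNReal.ofReal_ne_top hM
  have h2 := ae_lt_top' (AEMeasurable.tsum fun n => ((hX n).const_mul (a n)).enorm) h1
  filter_upwards [h2] with ω hω
  have h3 : Summable fun n => ‖a n * X n ω‖₊ := ENNReal.tsum_coe_ne_top_iff_summable.1 hω.ne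
  exact Summable.of_nnnorm h3

/-- The factors are exchanged one at a time, the others having norm at most one. -/
lemma norm_prod_sub_prod_le_sum {z w : ℕ → ℂ} (hz : ∀ n, ‖z n‖ ≤ 1) (hw : ∀ n, ‖w n‖ ≤ 1)
    (N : ℕ) : ‖∏ n ∈ Finset.range N, z n - ∏ n ∈ Finset.range N, w n‖ ≤
      ∑ n ∈ Finset.range N, ‖z n - w n‖ := by
  induction N with
  | zero => simp
  | succ N ih =>
    rw [Finset.prod_range_succ, Finset.prod_range_succ, Finset.sum_range_succ]
    have e : (∏ n ∈ Finset.range N, z n) * z N - (∏ n ∈ Finset.range N, w n) * w N =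
        (∏ n ∈ Finset.range N, z n - ∏ n ∈ Finset.range N, w n) * z N +
          (∏ n ∈ Finset.range N, w n) * (z N - w N) := by ring
    rw [e]
    refine (norm_add_le _ _).trans ?_
    rw [norm_mul, norm_mul]
    have h1 : ‖∏ n ∈ Finset.range N, w n‖ ≤ 1 := by
      rw [norm_prod]
      exact Finset.prod_le_one (fun _ _ => norm_nonneg _) fun n _ => hw n
    refine add_le_add ?_ ?_
    · exact (mul_le_of_le_one_right (norm_nonneg _) (hz N)).trans ih
    · exact mul_le_of_le_one_left (norm_nonneg _) h1

lemma norm_foldedChar_div_le_one {δ x : ℝ} (h : 0 < foldedMass δ x) (s : ℝ) :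
    ‖foldedChar δ x s / foldedMass δ x‖ ≤ 1 := by
  rw [norm_div, Complex.norm_real, Real.norm_of_nonneg h.le, div_le_one h]
  refine (norm_integral_le_integral_norm _).trans (le_of_eq ?_)
  refine integral_congr_ae (ae_of_all _ fun w => ?_)
  simp only
  rw [norm_smul, Complex.norm_exp_I_mul_ofReal, mul_one,
    Real.norm_of_nonneg (foldedDensity_nonneg _ _ _)]

lemma exists_log_foldedMass_lipschitz {δ : ℝ} (hδ : 0 ≤ δ) :
    ∃ C, 0 ≤ C ∧ ∀ x y, 0 ≤ x → 0 ≤ y →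
      |Real.log (foldedMass δ y) - Real.log (foldedMass δ x)| ≤ C * |y - x| := by
  obtain ⟨L', L'', C, hC, h1, -, h3, -⟩ := exists_log_foldedMass_deriv_bounds hδ
  refine ⟨C, hC, fun x y hx hy => ?_⟩
  have := Convex.norm_image_sub_le_of_norm_hasDerivWithin_le
    (f := fun x => Real.log (foldedMass δ x)) (f' := L') (s := Set.Ici 0) (x := x) (y := y) (C := C)
    (fun w hw => (h1 w hw).hasDerivWithinAt)
    (fun w hw => (h3 w hw).trans (div_le_self hC
      (one_le_pow₀ (by have : (0 : ℝ) ≤ w := hw; linarith)))) (convex_Ici 0) hx hy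
  simpa using this

/-- The logarithm of `∏ foldedMass δ (r * a n)`. -/
noncomputable def logMass (δ : ℝ) (a : ℕ → ℝ) (r : ℝ) : ℝ :=
  ∑' n, Real.log (foldedMass δ (r * a n))

section WeightedSum

variable {δ : ℝ} {a : ℕ → ℝ}

lemma summable_log_foldedMass (hδ : 0 ≤ δ) (ha : Summable a) (ha0 : ∀ n, 0 ≤ a n) {r : ℝ}
    (hr : 0 ≤ r) : Summable fun n => Real.log (foldedMass δ (r * a n)) := by
  obtain ⟨C, hC, h⟩ := exists_log_foldedMass_lipschitz hδ
  refine Summable.of_norm_bounded (ha.mul_left (C * r)) fun n => ?_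
  have h1 := h 0 (r * a n) le_rfl (mul_nonneg hr (ha0 n))
  rw [foldedMass_zero, Real.log_one, sub_zero, sub_zero, abs_mul, abs_of_nonneg hr,
    abs_of_nonneg (ha0 n)] at h1
  rw [Real.norm_eq_abs]
  linarith

/-- Used to bound an exponential moment under the tilt of parameter `r`, which is a ratio of moment
generating functions at `r + 1` and `r`. -/
lemma exists_logMass_add_one_le (hδ : 0 ≤ δ) (ha : Summable a) (ha0 : ∀ n, 0 ≤ a n) :
    ∃ B, ∀ r, 0 ≤ r → logMass δ a (r + 1) ≤ logMass δ a r + B := by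
  obtain ⟨C, hC, h⟩ := exists_log_foldedMass_lipschitz hδ
  refine ⟨∑' n, C * a n, fun r hr => ?_⟩
  unfold logMass
  rw [← (summable_log_foldedMass hδ ha ha0 hr).tsum_add (ha.mul_left C)]
  refine (summable_log_foldedMass hδ ha ha0 (by linarith)).tsum_le_tsum (fun n => ?_)
    ((summable_log_foldedMass hδ ha ha0 hr).add (ha.mul_left C))
  have h1 := h (r * a n) ((r + 1) * a n) (mul_nonneg hr (ha0 n))
    (mul_nonneg (by linarith) (ha0 n))
  have h2 : (r + 1) * a n - r * a n = a n := by ring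
  rw [h2, abs_of_nonneg (ha0 n)] at h1
  linarith [le_abs_self (Real.log (foldedMass δ ((r + 1) * a n)) -
    Real.log (foldedMass δ (r * a n)))]

lemma summable_sq_of_summable (ha : Summable a) (ha0 : ∀ n, 0 ≤ a n) :
    Summable fun n => a n ^ 2 := by
  have h1 : ∀ᶠ n in atTop, a n < 1 := ha.tendsto_atTop_zero.eventually (gt_mem_nhds one_pos)
  refine Summable.of_norm_bounded_eventually_nat ha ?_
  filter_upwards [h1] with n hn
  rw [Real.norm_of_nonneg (sq_nonneg _)]
  nlinarith [ha0 n]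

variable {Ω : Type*} [MeasurableSpace Ω] {P : Measure Ω}
  {Y : ℕ → Ω → ℝ}

lemma integral_cexp_sum_range (hind : iIndepFun Y P) (hlaw : ∀ n, HasLaw (Y n) (foldedLaw δ) P)
    (r t : ℝ) (N : ℕ) :
    ∫ ω, Complex.exp ((r + t * Complex.I) * (∑ n ∈ Finset.range N, a n * Y n ω : ℝ)) ∂P =
      ∏ n ∈ Finset.range N, (Complex.exp (((r * a n) ^ 2 / 2 : ℝ)) *
        Complex.exp (Complex.I * (t * a n * (r * a n) : ℝ)) * foldedChar δ (r * a n) (t * a n)) := by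
  have h1 := (hind.precomp (Fin.val_injective (n := N))).integral_fun_prod_comp
    (f := fun i : Fin N => fun y : ℝ =>
      Complex.exp (((r * a i : ℝ) + (t * a i : ℝ) * Complex.I) * y))
    (fun i => (hlaw i).aemeasurable) (fun i => Measurable.aestronglyMeasurable (by fun_prop))
  have h2 : ∀ i : Fin N, ∫ ω, Complex.exp (((r * a i : ℝ) + (t * a i : ℝ) * Complex.I) * (Y i ω)) ∂P
      = Complex.exp (((r * a i) ^ 2 / 2 : ℝ)) *
        Complex.exp (Complex.I * (t * a i * (r * a i) : ℝ)) * foldedChar δ (r * a i) (t * a i) := by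
    intro i
    rw [← integral_cexp_foldedLaw]
    exact (hlaw i).integral_comp
      (f := fun y : ℝ => Complex.exp (((r * a i : ℝ) + (t * a i : ℝ) * Complex.I) * y))
      (Measurable.aestronglyMeasurable (by fun_prop))
  rw [Finset.prod_congr rfl (fun i _ => h2 i)] at h1
  rw [Finset.prod_range, ← h1]
  refine integral_congr_ae (ae_of_all _ fun ω => ?_)
  simp only
  rw [← Complex.exp_sum, Finset.sum_range]
  congr 1
  push_cast
  rw [Finset.mul_sum]
  refine Finset.sum_congr rfl fun i _ => ?_
  ring

lemma integral_exp_sum_range (hind : iIndepFun Y P) (hlaw : ∀ n, HasLaw (Y n) (foldedLaw δ) P)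
    (r : ℝ) (N : ℕ) :
    ∫ ω, Real.exp (r * ∑ n ∈ Finset.range N, a n * Y n ω) ∂P =
      ∏ n ∈ Finset.range N, (Real.exp ((r * a n) ^ 2 / 2) * foldedMass δ (r * a n)) := by
  have h1 := (hind.precomp (Fin.val_injective (n := N))).integral_fun_prod_comp
    (f := fun i : Fin N => fun y : ℝ => Real.exp (r * a i * y))
    (fun i => (hlaw i).aemeasurable) (fun i => Measurable.aestronglyMeasurable (by fun_prop))
  have h2 : ∀ i : Fin N, ∫ ω, Real.exp (r * a i * (Y i ω)) ∂P
      = Real.exp ((r * a i) ^ 2 / 2) * foldedMass δ (r * a i) := by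
    intro i
    rw [← integral_exp_foldedLaw]
    exact (hlaw i).integral_comp (f := fun y : ℝ => Real.exp (r * a i * y))
      (Measurable.aestronglyMeasurable (by fun_prop))
  rw [Finset.prod_congr rfl (fun i _ => h2 i)] at h1
  rw [Finset.prod_range, ← h1]
  refine integral_congr_ae (ae_of_all _ fun ω => ?_)
  simp only
  rw [← Real.exp_sum, Finset.sum_range, Finset.mul_sum]
  congr 1
  refine Finset.sum_congr rfl fun i _ => ?_
  ring

lemma ae_summable_mul (hδ : 0 ≤ δ) (hlaw : ∀ n, HasLaw (Y n) (foldedLaw δ) P)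
    (ha : Summable a) (ha0 : ∀ n, 0 ≤ a n) : ∀ᵐ ω ∂P, Summable fun n => a n * Y n ω := by
  refine ae_summable_mul_of_lintegral_le (fun n => (hlaw n).aemeasurable)
    (M := ∫⁻ w, ‖w‖ₑ ∂foldedLaw δ) ?_ (fun n => ?_) ha ha0
  · exact (integrable_id_foldedLaw δ hδ).2.ne
  · rw [(hlaw n).lintegral_comp (f := fun w => ‖w‖ₑ) (by fun_prop)]

lemma ae_forall_neg_le (hlaw : ∀ n, HasLaw (Y n) (foldedLaw δ) P) :
    ∀ᵐ ω ∂P, ∀ n, -δ ≤ Y n ω := by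
  rw [ae_all_iff]
  intro n
  have h := ae_neg_le_foldedLaw δ
  rw [← (hlaw n).map_eq] at h
  exact ae_of_ae_map (hlaw n).aemeasurable h

lemma tendsto_prod_exp_mul_foldedMass (hδ : 0 ≤ δ) (ha : Summable a) (ha0 : ∀ n, 0 ≤ a n) {r : ℝ}
    (hr : 0 ≤ r) :
    Tendsto (fun N => ∏ n ∈ Finset.range N, (Real.exp ((r * a n) ^ 2 / 2) * foldedMass δ (r * a n)))
      atTop (𝓝 (Real.exp (r ^ 2 / 2 * ∑' n, a n ^ 2 + logMass δ a r))) := by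
  have h1 : ∀ n, Real.exp ((r * a n) ^ 2 / 2) * foldedMass δ (r * a n) =
      Real.exp (r ^ 2 / 2 * a n ^ 2 + Real.log (foldedMass δ (r * a n))) := by
    intro n
    rw [Real.exp_add, Real.exp_log (foldedMass_pos hδ (mul_nonneg hr (ha0 n)))]
    ring_nf
  simp_rw [h1, ← Real.exp_sum]
  refine (Real.continuous_exp.tendsto _).comp ?_
  have h2 := ((summable_sq_of_summable ha ha0).mul_left (r ^ 2 / 2)).hasSum.add
    (summable_log_foldedMass hδ ha ha0 hr).hasSum
  rw [tsum_mul_left] at h2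
  exact h2.tendsto_sum_nat

lemma aemeasurable_tsum_mul (hlaw : ∀ n, HasLaw (Y n) (foldedLaw δ) P) :
    AEMeasurable (fun ω => ∑' n, a n * Y n ω) P :=
  AEMeasurable.tsum fun n => (hlaw n).aemeasurable.const_mul (a n)

/-- The moment generating function of `∑ a n * Y n`. -/
lemma integrable_and_integral_exp_tsum (hδ : 0 ≤ δ) (hind : iIndepFun Y P)
    (hlaw : ∀ n, HasLaw (Y n) (foldedLaw δ) P) (ha : Summable a) (ha0 : ∀ n, 0 ≤ a n) {r : ℝ}
    (hr : 0 ≤ r) :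
    Integrable (fun ω => Real.exp (r * ∑' n, a n * Y n ω)) P ∧
    ∫ ω, Real.exp (r * ∑' n, a n * Y n ω) ∂P =
      Real.exp (r ^ 2 / 2 * ∑' n, a n ^ 2 + logMass δ a r) := by
  have hVm := aemeasurable_tsum_mul (a := a) hlaw
  -- The deterministic factor replaces `Yₙ` by `Yₙ + δ ≥ 0`. The partial sums then increase, and
  -- monotone convergence gives integrability and value together.
  set f : ℕ → Ω → ℝ := fun N ω => Real.exp (r * (δ * ∑ n ∈ Finset.range N, a n)) *
    Real.exp (r * ∑ n ∈ Finset.range N, a n * Y n ω) with hf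
  set F : Ω → ℝ := fun ω => Real.exp (r * (δ * ∑' n, a n)) *
    Real.exp (r * ∑' n, a n * Y n ω) with hF
  have hfm : ∀ N, AEMeasurable (f N) P := by
    intro N
    have : ∀ n, AEMeasurable (Y n) P := fun n => (hlaw n).aemeasurable
    have h2 : AEMeasurable (fun ω => ∑ n ∈ Finset.range N, a n * Y n ω) P :=
      Finset.aemeasurable_fun_sum _ fun n _ => (this n).const_mul (a n)
    exact ((h2.const_mul r).exp).const_mul _
  -- A nonintegrable function has Bochner integral `0`, whereas the integral is a product of
  -- positive factors.
  have hfi : ∀ N, Integrable (fun ω => Real.exp (r * ∑ n ∈ Finset.range N, a n * Y n ω)) P := by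
    intro N
    by_contra h
    have h1 := integral_undef h
    rw [integral_exp_sum_range hind hlaw] at h1
    rw [Finset.prod_eq_zero_iff] at h1
    obtain ⟨n, -, hn⟩ := h1
    have := foldedMass_pos hδ (mul_nonneg hr (ha0 n))
    exact absurd hn (by positivity)
  have hlim := lintegral_tendsto_of_tendsto_of_monotone (μ := P)
    (f := fun N ω => ENNReal.ofReal (f N ω)) (F := fun ω => ENNReal.ofReal (F ω))
    (fun N => (hfm N).ennreal_ofReal)
    (by
      filter_upwards [ae_forall_neg_le hlaw] with ω hω
      refine monotone_nat_of_le_succ fun N => ENNReal.ofReal_le_ofReal ?_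
      simp only [hf]
      rw [← Real.exp_add, ← Real.exp_add, Real.exp_le_exp, Finset.sum_range_succ,
        Finset.sum_range_succ]
      have h1 := mul_nonneg hr (mul_nonneg (ha0 N) (by linarith [hω N] : 0 ≤ Y N ω + δ))
      nlinarith)
    (by
      filter_upwards [ae_summable_mul hδ hlaw ha ha0] with ω hω
      refine ENNReal.tendsto_ofReal ?_
      refine Tendsto.mul ?_ ?_
      · exact (Real.continuous_exp.tendsto _).comp
          ((ha.hasSum.tendsto_sum_nat.const_mul δ).const_mul r)
      · exact (Real.continuous_exp.tendsto _).comp (hω.hasSum.tendsto_sum_nat.const_mul r))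
  have hval : ∀ N, ∫⁻ ω, ENNReal.ofReal (f N ω) ∂P =
      ENNReal.ofReal (Real.exp (r * (δ * ∑ n ∈ Finset.range N, a n)) *
        ∏ n ∈ Finset.range N, (Real.exp ((r * a n) ^ 2 / 2) * foldedMass δ (r * a n))) := by
    intro N
    rw [← ofReal_integral_eq_lintegral_ofReal ((hfi N).const_mul _)
      (ae_of_all _ fun ω => by positivity)]
    rw [integral_const_mul, integral_exp_sum_range hind hlaw]
  simp_rw [hval] at hlim
  have hlim2 : Tendsto (fun N => ENNReal.ofReal (Real.exp (r * (δ * ∑ n ∈ Finset.range N, a n)) *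
        ∏ n ∈ Finset.range N, (Real.exp ((r * a n) ^ 2 / 2) * foldedMass δ (r * a n)))) atTop
      (𝓝 (ENNReal.ofReal (Real.exp (r * (δ * ∑' n, a n)) *
        Real.exp (r ^ 2 / 2 * ∑' n, a n ^ 2 + logMass δ a r)))) := by
    refine ENNReal.tendsto_ofReal (Tendsto.mul ?_ (tendsto_prod_exp_mul_foldedMass hδ ha ha0 hr))
    exact (Real.continuous_exp.tendsto _).comp
          ((ha.hasSum.tendsto_sum_nat.const_mul δ).const_mul r)
  have heq := tendsto_nhds_unique hlim hlim2
  have hFm : AEMeasurable F P := ((hVm.const_mul r).exp).const_mul _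
  have hF0 : 0 ≤ᵐ[P] F := ae_of_all _ fun ω => by simp only [hF, Pi.zero_apply]; positivity
  have hFi : Integrable F P := by
    refine ⟨hFm.aestronglyMeasurable, ?_⟩
    rw [hasFiniteIntegral_iff_ofReal hF0, heq]
    exact ENNReal.ofReal_lt_top
  have hFint : ∫ ω, F ω ∂P = Real.exp (r * (δ * ∑' n, a n)) *
        Real.exp (r ^ 2 / 2 * ∑' n, a n ^ 2 + logMass δ a r) := by
    rw [integral_eq_lintegral_of_nonneg_ae hF0 hFm.aestronglyMeasurable, heq,
      ENNReal.toReal_ofReal (by positivity)]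
  constructor
  · exact (integrable_const_mul_iff (Real.exp_pos _).ne'.isUnit _).1 hFi
  · simp only [hF] at hFint
    rw [integral_const_mul] at hFint
    exact mul_left_cancel₀ (Real.exp_pos _).ne' hFint

/-- Dominated convergence: since `aₙ(Yₙ + δ) ≥ 0`, every partial sum is at most the full sum plus `δ
∑ aₙ`. -/
lemma tendsto_integral_cexp_sum_range (hδ : 0 ≤ δ) (hind : iIndepFun Y P)
    (hlaw : ∀ n, HasLaw (Y n) (foldedLaw δ) P) (ha : Summable a) (ha0 : ∀ n, 0 ≤ a n) {r : ℝ}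
    (hr : 0 ≤ r) (t : ℝ) :
    Tendsto (fun N => ∫ ω, Complex.exp ((r + t * Complex.I) *
        (∑ n ∈ Finset.range N, a n * Y n ω : ℝ)) ∂P) atTop
      (𝓝 (∫ ω, Complex.exp ((r + t * Complex.I) * (∑' n, a n * Y n ω : ℝ)) ∂P)) := by
  refine tendsto_integral_of_dominated_convergence
    (fun ω => Real.exp (r * (δ * ∑' n, a n)) * Real.exp (r * ∑' n, a n * Y n ω)) ?_ ?_ ?_ ?_
  · intro N
    have h2 : AEMeasurable (fun ω => ∑ n ∈ Finset.range N, a n * Y n ω) P :=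
      Finset.aemeasurable_fun_sum _ fun n _ => (hlaw n).aemeasurable.const_mul (a n)
    exact AEMeasurable.aestronglyMeasurable (by fun_prop)
  · exact ((integrable_and_integral_exp_tsum hδ hind hlaw ha ha0 hr).1).const_mul _
  · intro N
    filter_upwards [ae_forall_neg_le hlaw, ae_summable_mul hδ hlaw ha ha0] with ω h1 h2
    rw [Complex.norm_exp, ← Real.exp_add, Real.exp_le_exp]
    have h3 : ∑ n ∈ Finset.range N, (a n * Y n ω + δ * a n) ≤ ∑' n, (a n * Y n ω + δ * a n) := by
      refine Summable.sum_le_tsum _ (fun n _ => ?_) (h2.add (ha.mul_left δ))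
      have := mul_nonneg (ha0 n) (by linarith [h1 n] : 0 ≤ Y n ω + δ)
      linarith
    rw [h2.tsum_add (ha.mul_left δ), tsum_mul_left, Finset.sum_add_distrib] at h3
    have h4 : 0 ≤ ∑ n ∈ Finset.range N, δ * a n :=
      Finset.sum_nonneg fun n _ => mul_nonneg hδ (ha0 n)
    have h5 : ((r + t * Complex.I) * ((∑ n ∈ Finset.range N, a n * Y n ω : ℝ) : ℂ)).re =
        r * ∑ n ∈ Finset.range N, a n * Y n ω := by
      rw [Complex.re_mul_ofReal]; simp
    rw [h5, ← mul_add]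
    exact mul_le_mul_of_nonneg_left (by linarith) hr
  · filter_upwards [ae_summable_mul hδ hlaw ha ha0] with ω h2
    refine (Complex.continuous_exp.tendsto _).comp (Tendsto.const_mul _ ?_)
    exact (Complex.continuous_ofReal.tendsto _).comp h2.hasSum.tendsto_sum_nat

/-- The characteristic function of `∑ a n * Y n - r * ∑ a n ^ 2` under the exponential tilt of
parameter `r` converges to the Gaussian one. -/
lemma tendsto_tilted_charFun (hδ : 0 ≤ δ) (hind : iIndepFun Y P)
    (hlaw : ∀ n, HasLaw (Y n) (foldedLaw δ) P) (ha : Summable a) (ha0 : ∀ n, 0 < a n) (t : ℝ) :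
    Tendsto (fun r : ℝ => (∫ ω, Complex.exp ((r + t * Complex.I) * (∑' n, a n * Y n ω : ℝ)) ∂P) *
        Complex.exp (-(Complex.I * (t * (r * ∑' n, a n ^ 2) : ℝ))) /
        (Real.exp (r ^ 2 / 2 * ∑' n, a n ^ 2 + logMass δ a r) : ℝ)) atTop
      (𝓝 (Real.exp (-(t ^ 2 / 2 * ∑' n, a n ^ 2)) : ℂ)) := by
  obtain ⟨C, hC, hχC⟩ := exists_norm_foldedChar_div_sub_le hδ
  have hsq := summable_sq_of_summable ha fun n => (ha0 n).le
  -- The error of one factor. Each tends to `0` as `r → ∞` because `aₙ > 0`, and all are dominated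
  -- by a multiple of `aₙ`.
  set e : ℝ → ℕ → ℝ := fun r n => ‖foldedChar δ (r * a n) (t * a n) / foldedMass δ (r * a n) -
    (Real.exp (-((t * a n) ^ 2 / 2)) : ℂ)‖ with he
  have hbs : Summable fun n => C * |t| * a n := ha.mul_left _
  have heb : ∀ r, 0 ≤ r → ∀ n, ‖e r n‖ ≤ C * |t| * a n := by
    intro r hr n
    simp only [he, norm_norm]
    refine (hχC _ (t * a n) (mul_nonneg hr (ha0 n).le)).trans (le_of_eq ?_)
    rw [abs_mul, abs_of_pos (ha0 n)]; ring
  have hlim0 : Tendsto (fun r => ∑' n, e r n) atTop (𝓝 0) := by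
    have : Tendsto (fun r => ∑' n, e r n) atTop (𝓝 (∑' n : ℕ, (0 : ℝ))) := by
      refine tendsto_tsum_of_dominated_convergence hbs (fun n => ?_) ?_
      · exact (tendsto_norm_foldedChar_div_sub hδ (t * a n)).comp
          (tendsto_id.atTop_mul_const (ha0 n))
      · filter_upwards [eventually_ge_atTop 0] with r hr
        exact heb r hr
    simpa using this
  rw [tendsto_iff_norm_sub_tendsto_zero]
  refine squeeze_zero' (Eventually.of_forall fun _ => norm_nonneg _) ?_ hlim0
  filter_upwards [eventually_ge_atTop 0] with r hr
  have hmass : ∀ n, 0 < foldedMass δ (r * a n) := fun n =>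
    foldedMass_pos hδ (mul_nonneg hr (ha0 n).le)
  have hA := tendsto_integral_cexp_sum_range hδ hind hlaw ha (fun n => (ha0 n).le) hr t
  have hB : Tendsto (fun N => Complex.exp (-(Complex.I *
      (t * (r * ∑ n ∈ Finset.range N, a n ^ 2) : ℝ)))) atTop
      (𝓝 (Complex.exp (-(Complex.I * (t * (r * ∑' n, a n ^ 2) : ℝ))))) := by
    refine (Complex.continuous_exp.tendsto _).comp (Tendsto.neg (Tendsto.const_mul _ ?_))
    exact (Complex.continuous_ofReal.tendsto _).comp
      ((hsq.hasSum.tendsto_sum_nat.const_mul r).const_mul t)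
  have hD : Tendsto (fun N => ((∏ n ∈ Finset.range N,
      (Real.exp ((r * a n) ^ 2 / 2) * foldedMass δ (r * a n)) : ℝ) : ℂ)) atTop
      (𝓝 (Real.exp (r ^ 2 / 2 * ∑' n, a n ^ 2 + logMass δ a r) : ℝ)) :=
    (Complex.continuous_ofReal.tendsto _).comp
      (tendsto_prod_exp_mul_foldedMass hδ ha (fun n => (ha0 n).le) hr)
  have hE : Tendsto (fun N => ((Real.exp (-(t ^ 2 / 2 * ∑ n ∈ Finset.range N, a n ^ 2)) : ℝ) : ℂ))
      atTop (𝓝 (Real.exp (-(t ^ 2 / 2 * ∑' n, a n ^ 2)) : ℝ)) :=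
    (Complex.continuous_ofReal.tendsto _).comp ((Real.continuous_exp.tendsto _).comp
      (hsq.hasSum.tendsto_sum_nat.const_mul _).neg)
  have hne : ((Real.exp (r ^ 2 / 2 * ∑' n, a n ^ 2 + logMass δ a r) : ℝ) : ℂ) ≠ 0 := by
    exact_mod_cast (Real.exp_pos _).ne'
  have hall := (((hA.mul hB).div hD hne).sub hE).norm
  -- The bound is proved for finite products, where the phases `exp(i t aₙ · r aₙ)` cancel against
  -- the centring and the Gaussian factors against the normalisation.
  refine le_of_tendsto hall (Eventually.of_forall fun N => ?_)
  have hsum : Summable (e r) := Summable.of_norm_bounded hbs (heb r hr)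
  refine le_trans ?_ (hsum.sum_le_tsum (Finset.range N) fun n _ => norm_nonneg _)
  refine le_trans (le_of_eq ?_) (norm_prod_sub_prod_le_sum
    (z := fun n => foldedChar δ (r * a n) (t * a n) / foldedMass δ (r * a n))
    (w := fun n => (Real.exp (-((t * a n) ^ 2 / 2)) : ℂ))
    (fun n => norm_foldedChar_div_le_one (hmass n) _)
    (fun n => ?_) N)
  · congr 2
    · simp only [Pi.div_apply]
      rw [integral_cexp_sum_range hind hlaw]
      have h1 : Complex.exp (-(Complex.I * (t * (r * ∑ n ∈ Finset.range N, a n ^ 2) : ℝ))) =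
          ∏ n ∈ Finset.range N, Complex.exp (-(Complex.I * (t * a n * (r * a n) : ℝ))) := by
        rw [← Complex.exp_sum]
        congr 1
        push_cast
        rw [Finset.sum_neg_distrib, ← Finset.mul_sum, Finset.mul_sum, Finset.mul_sum]
        congr 2
        refine Finset.sum_congr rfl fun n _ => ?_
        ring
      rw [h1, Complex.ofReal_prod, ← Finset.prod_mul_distrib, ← Finset.prod_div_distrib]
      refine Finset.prod_congr rfl fun n _ => ?_
      have h2 : Complex.exp (Complex.I * (t * a n * (r * a n) : ℝ)) *
          Complex.exp (-(Complex.I * (t * a n * (r * a n) : ℝ))) = 1 := by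
        rw [← Complex.exp_add]; simp
      have h3 : Complex.exp (((r * a n) ^ 2 / 2 : ℝ)) ≠ 0 := Complex.exp_ne_zero _
      have h4 : (foldedMass δ (r * a n) : ℂ) ≠ 0 := by exact_mod_cast (hmass n).ne'
      rw [Complex.ofReal_mul (Real.exp _), Complex.ofReal_exp, div_eq_div_iff (mul_ne_zero h3 h4) h4]
      linear_combination (Complex.exp (((r * a n) ^ 2 / 2 : ℝ)) * foldedChar δ (r * a n) (t * a n) *
        foldedMass δ (r * a n)) * h2
    · rw [← Complex.ofReal_prod, ← Real.exp_sum, Finset.mul_sum, Finset.sum_neg_distrib]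
      congr 3
      refine Finset.sum_congr rfl fun n _ => ?_
      ring
  · rw [Complex.norm_real, Real.norm_of_nonneg (Real.exp_pos _).le, Real.exp_le_one_iff]
    have := sq_nonneg (t * a n)
    linarith

end WeightedSum

/-! ### The tail contributed by a single summand -/

/-- The conditional tail of a tilted sum, given that all summands but one add up to `R`. -/
noncomputable def tiltedTail (δ a₀ r R : ℝ) : ℝ :=
  ∫ u in Set.Ioi 0, Real.exp (-u) * foldedDensity δ (r * a₀) ((u / r - R) / a₀)

lemma measurable_tiltedTail (δ a₀ r : ℝ) : Measurable (tiltedTail δ a₀ r) := by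
  have h : Measurable fun p : ℝ × ℝ =>
      Real.exp (-p.2) * foldedDensity δ (r * a₀) ((p.2 / r - p.1) / a₀) := by fun_prop
  exact (h.stronglyMeasurable.integral_prod_right (ν := volume.restrict (Set.Ioi 0))).measurable

lemma integrableOn_mul_exp_neg : IntegrableOn (fun u : ℝ => Real.exp (-u) * u) (Set.Ioi 0) := by
  have := Real.GammaIntegral_convergent (s := 2) (by norm_num)
  refine this.congr_fun (fun u _ => ?_) measurableSet_Ioi
  simp only
  norm_num

lemma integral_mul_exp_neg : ∫ u in Set.Ioi (0 : ℝ), Real.exp (-u) * u = 1 := by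
  have h := Real.Gamma_eq_integral (s := 2) (by norm_num)
  rw [Real.Gamma_two] at h
  rw [h]
  refine setIntegral_congr_fun measurableSet_Ioi fun u _ => ?_
  norm_num

lemma integrableOn_exp_neg : IntegrableOn (fun u : ℝ => Real.exp (-u)) (Set.Ioi 0) :=
  integrableOn_exp_neg_Ioi 0

/-- Under the weight `exp(-u)` the argument `(u/r - R)/a₀` stays near `-R/a₀`, and the density there
is almost a multiple of the even function `stdPDF`. Since `exp(-u)` and `u exp(-u)` both integrate
to `1`, the errors `1/x` and `2u/x` add up to `3/x`. -/
lemma abs_tiltedTail_sub_le {δ a₀ r : ℝ} (hδ : 0 ≤ δ) (ha₀ : 0 < a₀) (hr : 0 < r) (R : ℝ) :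
    |tiltedTail δ a₀ r R - (1 + Real.exp (-(2 * δ * (r * a₀)))) * stdPDF (R / a₀)| ≤
      3 / (r * a₀) + 2 * Real.exp (R - a₀ ^ 2 * r) := by
  set x := r * a₀ with hx
  have hx0 : 0 < x := mul_pos hr ha₀
  set c := 1 + Real.exp (-(2 * δ * x)) with hc
  set E := Real.exp (R - a₀ ^ 2 * r) with hE
  have hc2 : c ≤ 2 := by have := exp_neg_two_mul_le_one hδ hx0.le; linarith
  have hc0 : 0 < c := by positivity
  have hpt : ∀ u : ℝ, 0 < u → |foldedDensity δ x ((u / r - R) / a₀) - c * stdPDF (R / a₀)| ≤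
      (1 / x + 2 * E) + 2 / x * u := by
    intro u hu
    set w := (u / r - R) / a₀ with hw
    have h1 := abs_foldedDensity_sub_le hδ hx0 w
    -- A Chernoff-type bound: on this set `R > a₀² r`, so the indicator is at most `exp(R - a₀² r)`,
    -- which can be averaged later.
    have h2 : Set.indicator (Set.Iio (-δ - x)) (1 : ℝ → ℝ) w ≤ E := by
      refine Set.indicator_apply_le' (fun h => ?_) fun _ => (Real.exp_pos _).le
      have h3 : w < -δ - x := h
      rw [hw, div_lt_iff₀ ha₀] at h3
      have h4 : 0 < u / r := by positivity
      have h5 : 0 ≤ δ * a₀ := by positivity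
      have h6 : x * a₀ = a₀ ^ 2 * r := by rw [hx]; ring
      exact Real.one_le_exp (by nlinarith)
    have h3 : |c * stdPDF w - c * stdPDF (R / a₀)| ≤ 2 / x * u := by
      rw [← mul_sub, abs_mul, abs_of_pos hc0, ← stdPDF_neg (R / a₀)]
      have h4 := abs_stdPDF_sub_le (-(R / a₀)) w
      have h5 : w - -(R / a₀) = u / x := by rw [hw, hx]; field_simp; ring
      rw [h5, abs_of_pos (by positivity : 0 < u / x)] at h4
      calc c * _ ≤ 2 * (u / x) := mul_le_mul hc2 h4 (abs_nonneg _) (by norm_num)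
        _ = _ := by ring
    have h4 := abs_add_le (foldedDensity δ x w - c * stdPDF w) (c * stdPDF w - c * stdPDF (R / a₀))
    rw [sub_add_sub_cancel] at h4
    linarith
  have hi1 : IntegrableOn (fun u => Real.exp (-u) * foldedDensity δ x ((u / r - R) / a₀))
      (Set.Ioi 0) := by
    refine (integrableOn_exp_neg.mul_const 2).mono' (Measurable.aestronglyMeasurable (by fun_prop))
      (ae_of_all _ fun u => ?_)
    rw [norm_mul, Real.norm_of_nonneg (Real.exp_pos _).le,
      Real.norm_of_nonneg (foldedDensity_nonneg _ _ _)]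
    gcongr
    exact foldedDensity_le_two hδ hx0.le _
  have hi2 : IntegrableOn (fun u => Real.exp (-u) * (c * stdPDF (R / a₀))) (Set.Ioi 0) :=
    integrableOn_exp_neg.mul_const _
  have e1 : tiltedTail δ a₀ r R - c * stdPDF (R / a₀) = ∫ u in Set.Ioi 0,
      (Real.exp (-u) * foldedDensity δ x ((u / r - R) / a₀) -
        Real.exp (-u) * (c * stdPDF (R / a₀))) := by
    rw [integral_sub hi1 hi2, integral_mul_const, integral_exp_neg_Ioi_zero, one_mul]
    rfl
  have hi3 : IntegrableOn (fun u => Real.exp (-u) * (1 / x + 2 * E) +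
      2 / x * (Real.exp (-u) * u)) (Set.Ioi 0) :=
    (integrableOn_exp_neg.mul_const _).add (integrableOn_mul_exp_neg.const_mul _)
  rw [e1, ← Real.norm_eq_abs]
  refine (norm_integral_le_of_norm_le hi3 ?_).trans (le_of_eq ?_)
  · refine (ae_restrict_iff' measurableSet_Ioi).2 (ae_of_all _ fun u hu => ?_)
    rw [← mul_sub, norm_mul, Real.norm_of_nonneg (Real.exp_pos _).le, Real.norm_eq_abs]
    refine (mul_le_mul_of_nonneg_left (hpt u hu) (Real.exp_pos _).le).trans (le_of_eq ?_)
    ring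
  · rw [integral_add (integrableOn_exp_neg.mul_const _) (integrableOn_mul_exp_neg.const_mul _),
      integral_mul_const, integral_const_mul, integral_mul_exp_neg, integral_exp_neg_Ioi_zero]
    ring

/-- The tail of one summand, rewritten after the exponential tilt. -/
lemma foldedLaw_real_tail_eq {δ a₀ σ2 r : ℝ} (ha₀ : 0 < a₀) (hr : 0 < r)
    (hone : a₀ ^ 2 + σ2 = 1) (v : ℝ) :
    (foldedLaw δ).real {y | r ≤ a₀ * y + v} =
      Real.exp (-(r ^ 2 / 2) - r ^ 2 / 2 * σ2) / (r * a₀) *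
        (Real.exp (r * v) * tiltedTail δ a₀ r (v - r * σ2)) := by
  -- The substitution `y = c + k u` makes `u = r (a₀ y + v - r)`, the excess over the threshold
  -- measured in units of `1/r`.
  set c := (r - v) / a₀ with hc
  set k := 1 / (r * a₀) with hk
  have hk0 : 0 < k := by positivity
  have hset : {y | r ≤ a₀ * y + v} = Set.Ici c := by
    ext y
    simp only [Set.mem_ofPred_eq, Set.mem_Ici, hc]
    rw [div_le_iff₀ ha₀]
    constructor <;> intro h <;> linarith
  have h1 : (foldedLaw δ).real (Set.Ici c) =
      ∫ w, Set.indicator (Set.Ici c) (foldedDensity δ 0) w := by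
    rw [← integral_indicator_one measurableSet_Ici, integral_foldedLaw]
    refine integral_congr_ae (ae_of_all _ fun w => ?_)
    by_cases h : w ∈ Set.Ici c <;> simp [h]
  have h2 : ∫ w, Set.indicator (Set.Ici c) (foldedDensity δ 0) w =
      k * ∫ u, Set.indicator (Set.Ici c) (foldedDensity δ 0) (c + k * u) := by
    rw [Measure.integral_comp_mul_left (fun y => Set.indicator (Set.Ici c) (foldedDensity δ 0)
      (c + y)) k, integral_add_left_eq_self, smul_eq_mul, abs_of_pos (by positivity),
      mul_inv_cancel_left₀ hk0.ne']
  have h3 : ∀ u, Set.indicator (Set.Ici c) (foldedDensity δ 0) (c + k * u) =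
      Set.indicator (Set.Ici 0) (fun u => Real.exp (-(r ^ 2 / 2) - r ^ 2 / 2 * σ2 + r * v) *
        (Real.exp (-u) * foldedDensity δ (r * a₀) ((u / r - (v - r * σ2)) / a₀))) u := by
    intro u
    have hiff : c + k * u ∈ Set.Ici c ↔ u ∈ Set.Ici (0 : ℝ) := by
      simp only [Set.mem_Ici, le_add_iff_nonneg_right]
      exact mul_nonneg_iff_of_pos_left hk0
    by_cases h : u ∈ Set.Ici (0 : ℝ)
    · rw [Set.indicator_of_mem h, Set.indicator_of_mem (hiff.2 h),
        foldedDensity_zero_eq δ (r * a₀) (c + k * u), ← mul_assoc, ← Real.exp_add, ← Real.exp_add]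
      have hσ : σ2 = 1 - a₀ ^ 2 := by linarith
      have e1 : r * a₀ * (c + k * u) = r * (r - v) + u := by
        rw [hc, hk]; field_simp
      have e2 : c + k * u - r * a₀ = (u / r - (v - r * σ2)) / a₀ := by
        rw [hc, hk, hσ]; field_simp; ring
      rw [e1, e2, hσ]
      ring_nf
    · rw [Set.indicator_of_notMem h, Set.indicator_of_notMem (fun h' => h (hiff.1 h'))]
  rw [hset, h1, h2]
  simp_rw [h3]
  rw [integral_indicator measurableSet_Ici, integral_const_mul, integral_Ici_eq_integral_Ioi,
    Real.exp_add, tiltedTail, hk]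
  ring

/-! ### Limits under the tilted measure -/

section Tilted

variable {δ : ℝ} {a : ℕ → ℝ} {Ω : Type*} [MeasurableSpace Ω] {P : Measure Ω} {Y : ℕ → Ω → ℝ}

lemma isProbabilityMeasure_tilted_tsum (hδ : 0 ≤ δ) (hind : iIndepFun Y P)
    (hlaw : ∀ n, HasLaw (Y n) (foldedLaw δ) P) (ha : Summable a) (ha0 : ∀ n, 0 < a n) {r : ℝ}
    (hr : 0 ≤ r) : IsProbabilityMeasure (P.tilted fun ω => r * ∑' n, a n * Y n ω) := by
  have := hind.isProbabilityMeasure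
  exact isProbabilityMeasure_tilted
    (integrable_and_integral_exp_tsum hδ hind hlaw ha (fun n => (ha0 n).le) hr).1

lemma aemeasurable_tsum_mul_tilted (hlaw : ∀ n, HasLaw (Y n) (foldedLaw δ) P) (r : ℝ) :
    AEMeasurable (fun ω => ∑' n, a n * Y n ω) (P.tilted fun ω => r * ∑' n, a n * Y n ω) :=
  (aemeasurable_tsum_mul hlaw).mono_ac (tilted_absolutelyContinuous _ _)

lemma integral_tilted_cexp (hδ : 0 ≤ δ) (hind : iIndepFun Y P)
    (hlaw : ∀ n, HasLaw (Y n) (foldedLaw δ) P) (ha : Summable a) (ha0 : ∀ n, 0 < a n) {r : ℝ}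
    (hr : 0 ≤ r) (t σ2 : ℝ) :
    ∫ ω, Complex.exp (Complex.I * (t * (∑' n, a n * Y n ω - r * σ2) : ℝ))
        ∂(P.tilted fun ω => r * ∑' n, a n * Y n ω) =
      (∫ ω, Complex.exp ((r + t * Complex.I) * (∑' n, a n * Y n ω : ℝ)) ∂P) *
        Complex.exp (-(Complex.I * (t * (r * σ2) : ℝ))) /
        (Real.exp (r ^ 2 / 2 * ∑' n, a n ^ 2 + logMass δ a r) : ℝ) := by
  rw [integral_tilted, (integrable_and_integral_exp_tsum hδ hind hlaw ha
    (fun n => (ha0 n).le) hr).2, mul_div_assoc, ← integral_mul_const]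
  refine integral_congr_ae (ae_of_all _ fun ω => ?_)
  simp only [Complex.real_smul]
  rw [Complex.ofReal_div, Complex.ofReal_exp (r * _), div_mul_eq_mul_div, ← mul_div_assoc,
    ← Complex.exp_add, ← Complex.exp_add]
  congr 2
  push_cast
  ring

/-- The Gaussian is its own Fourier transform, so Fubini turns the expectation into an integral of
characteristic functions against `stdPDF`, and dominated convergence applies. The limit is `a₀`
times the density at `0` of a centred normal variable of variance `a₀² + ∑ aₙ² = 1`. -/
lemma tendsto_integral_tilted_stdPDF (hδ : 0 ≤ δ) (hind : iIndepFun Y P)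
    (hlaw : ∀ n, HasLaw (Y n) (foldedLaw δ) P) (ha : Summable a) (ha0 : ∀ n, 0 < a n) {a₀ : ℝ}
    (ha₀ : 0 < a₀) (hone : a₀ ^ 2 + ∑' n, a n ^ 2 = 1) :
    Tendsto (fun r => ∫ ω, stdPDF ((∑' n, a n * Y n ω - r * ∑' n, a n ^ 2) / a₀)
        ∂(P.tilted fun ω => r * ∑' n, a n * Y n ω)) atTop (𝓝 (a₀ * (√(2 * Real.pi))⁻¹)) := by
  set σ2 := ∑' n, a n ^ 2 with hσ2
  set B : ℝ → ℝ → ℂ := fun r g => ∫ ω, Complex.exp (Complex.I *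
    (g / a₀ * (∑' n, a n * Y n ω - r * σ2) : ℝ)) ∂(P.tilted fun ω => r * ∑' n, a n * Y n ω) with hB
  have hBlim : ∀ g, Tendsto (fun r => B r g) atTop
      (𝓝 (Real.exp (-((g / a₀) ^ 2 / 2 * σ2)) : ℂ)) := by
    intro g
    refine (tendsto_tilted_charFun hδ hind hlaw ha ha0 (g / a₀)).congr' ?_
    filter_upwards [eventually_ge_atTop 0] with r hr
    exact (integral_tilted_cexp hδ hind hlaw ha ha0 hr (g / a₀) σ2).symm
  have hjoint : ∀ r, 0 ≤ r → Integrable (fun p : Ω × ℝ => stdPDF p.2 • Complex.exp (Complex.I *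
      ((∑' n, a n * Y n p.1 - r * σ2) / a₀ * p.2 : ℝ)))
      ((P.tilted fun ω => r * ∑' n, a n * Y n ω).prod volume) := by
    intro r hr
    have := isProbabilityMeasure_tilted_tsum hδ hind hlaw ha ha0 hr
    have hm := (aemeasurable_tsum_mul_tilted (a := a) hlaw r).comp_fst (ν := (volume : Measure ℝ))
    have h1 : Integrable (fun p : Ω × ℝ => stdPDF p.2)
        ((P.tilted fun ω => r * ∑' n, a n * Y n ω).prod volume) := integrable_stdPDF.comp_snd _
    refine h1.mono' (AEMeasurable.aestronglyMeasurable (by fun_prop)) (ae_of_all _ fun p => ?_)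
    rw [norm_smul, Complex.norm_exp_I_mul_ofReal, mul_one, Real.norm_of_nonneg (stdPDF_pos _).le]
  have hBn : ∀ r, 0 ≤ r → ∀ g, ‖B r g‖ ≤ 1 := by
    intro r hr g
    have := isProbabilityMeasure_tilted_tsum hδ hind hlaw ha ha0 hr
    refine (norm_integral_le_integral_norm _).trans (le_of_eq ?_)
    simp_rw [Complex.norm_exp_I_mul_ofReal]
    simp
  have hswap : ∀ r, 0 ≤ r → ((∫ ω, stdPDF ((∑' n, a n * Y n ω - r * σ2) / a₀)
        ∂(P.tilted fun ω => r * ∑' n, a n * Y n ω) : ℝ) : ℂ) =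
      ((√(2 * Real.pi))⁻¹ : ℝ) * ∫ g, stdPDF g • B r g := by
    intro r hr
    have := isProbabilityMeasure_tilted_tsum hδ hind hlaw ha ha0 hr
    have h1 := integral_integral_swap (f := fun ω g => stdPDF g • Complex.exp (Complex.I *
      ((∑' n, a n * Y n ω - r * σ2) / a₀ * g : ℝ))) (hjoint r hr)
    simp_rw [integral_stdPDF_smul_cexp] at h1
    simp_rw [stdPDF_eq]
    rw [integral_const_mul, Complex.ofReal_mul, ← integral_complex_ofReal, h1]
    congr 1
    refine integral_congr_ae (ae_of_all _ fun g => ?_)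
    simp only [hB]
    rw [← integral_smul]
    refine integral_congr_ae (ae_of_all _ fun ω => ?_)
    simp only
    rw [← stdPDF_eq]
    congr 4
    ring
  have hlim : Tendsto (fun r => ∫ g, stdPDF g • B r g) atTop
      (𝓝 (∫ g, stdPDF g • (Real.exp (-((g / a₀) ^ 2 / 2 * σ2)) : ℂ))) := by
    refine tendsto_integral_filter_of_dominated_convergence stdPDF ?_ ?_ integrable_stdPDF ?_
    · filter_upwards [eventually_ge_atTop 0] with r hr
      have := isProbabilityMeasure_tilted_tsum hδ hind hlaw ha ha0 hr
      have h1 := (hjoint r hr).swap.integral_prod_left.aestronglyMeasurable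
      refine h1.congr (ae_of_all _ fun g => ?_)
      simp only [Function.comp_apply, Prod.swap_prod_mk, hB]
      rw [← integral_smul]
      refine integral_congr_ae (ae_of_all _ fun ω => ?_)
      simp only
      congr 4
      ring
    · filter_upwards [eventually_ge_atTop 0] with r hr
      refine ae_of_all _ fun g => ?_
      rw [norm_smul, Real.norm_of_nonneg (stdPDF_pos _).le]
      exact mul_le_of_le_one_right (stdPDF_pos _).le (hBn r hr g)
    · exact ae_of_all _ fun g => (hBlim g).const_smul _
  have hval : ∫ g, stdPDF g • (Real.exp (-((g / a₀) ^ 2 / 2 * σ2)) : ℂ) = (a₀ : ℂ) := by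
    have h1 : ∀ g, stdPDF g • (Real.exp (-((g / a₀) ^ 2 / 2 * σ2)) : ℂ) =
        ((stdPDF (g / a₀) : ℝ) : ℂ) := by
      intro g
      rw [Complex.real_smul, ← Complex.ofReal_mul, stdPDF_eq, stdPDF_eq, mul_assoc, ← Real.exp_add]
      congr 3
      have : σ2 = 1 - a₀ ^ 2 := by linarith
      rw [this]
      field_simp
      ring
    simp_rw [h1]
    rw [integral_complex_ofReal, Measure.integral_comp_div, integral_stdPDF, abs_of_pos ha₀]
    simp
  rw [hval] at hlim
  have h2 := hlim.const_mul (((√(2 * Real.pi))⁻¹ : ℝ) : ℂ)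
  have h3 : Tendsto (fun r => ((∫ ω, stdPDF ((∑' n, a n * Y n ω - r * σ2) / a₀)
        ∂(P.tilted fun ω => r * ∑' n, a n * Y n ω) : ℝ) : ℂ)) atTop
      (𝓝 ((a₀ * (√(2 * Real.pi))⁻¹ : ℝ) : ℂ)) := by
    rw [mul_comm a₀, Complex.ofReal_mul]
    refine h2.congr' ?_
    filter_upwards [eventually_ge_atTop 0] with r hr
    exact (hswap r hr).symm
  exact Complex.continuous_re.tendsto _ |>.comp h3

/-- The expectation is the ratio of moment generating functions at `r + 1` and `r` times
`exp(-rσ²)`; the quadratic terms leave only `σ²/2`. -/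
lemma exists_integral_tilted_exp_le (hδ : 0 ≤ δ) (hind : iIndepFun Y P)
    (hlaw : ∀ n, HasLaw (Y n) (foldedLaw δ) P) (ha : Summable a) (ha0 : ∀ n, 0 < a n) :
    ∃ B, ∀ r, 0 ≤ r →
      Integrable (fun ω => Real.exp (∑' n, a n * Y n ω - r * ∑' n, a n ^ 2))
        (P.tilted fun ω => r * ∑' n, a n * Y n ω) ∧
      ∫ ω, Real.exp (∑' n, a n * Y n ω - r * ∑' n, a n ^ 2)
        ∂(P.tilted fun ω => r * ∑' n, a n * Y n ω) ≤ B := by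
  obtain ⟨B, hB⟩ := exists_logMass_add_one_le hδ ha fun n => (ha0 n).le
  set σ2 := ∑' n, a n ^ 2 with hσ2
  refine ⟨Real.exp (σ2 / 2 + B), fun r hr => ?_⟩
  obtain ⟨hi, hv⟩ := integrable_and_integral_exp_tsum hδ hind hlaw ha (fun n => (ha0 n).le) hr
  obtain ⟨hi', hv'⟩ := integrable_and_integral_exp_tsum hδ hind hlaw ha (fun n => (ha0 n).le)
    (r := r + 1) (by linarith)
  constructor
  · rw [integrable_tilted_iff hi]
    refine (hi'.mul_const (Real.exp (-(r * σ2)))).congr (ae_of_all _ fun ω => ?_)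
    simp only [smul_eq_mul]
    rw [← Real.exp_add, ← Real.exp_add]
    ring_nf
  · rw [integral_exp_tilted]
    have h1 : ∀ ω, Real.exp (((fun ω => r * ∑' n, a n * Y n ω) +
        fun ω => ∑' n, a n * Y n ω - r * σ2) ω) =
        Real.exp ((r + 1) * ∑' n, a n * Y n ω) * Real.exp (-(r * σ2)) := by
      intro ω
      rw [← Real.exp_add, Pi.add_apply]
      ring_nf
    simp_rw [h1]
    rw [integral_mul_const, hv, hv', ← Real.exp_add, ← Real.exp_sub, Real.exp_le_exp]
    have := hB r hr
    nlinarith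

lemma tendsto_integral_tilted_tiltedTail (hδ : 0 ≤ δ) (hind : iIndepFun Y P)
    (hlaw : ∀ n, HasLaw (Y n) (foldedLaw δ) P) (ha : Summable a) (ha0 : ∀ n, 0 < a n) {a₀ : ℝ}
    (ha₀ : 0 < a₀) (hone : a₀ ^ 2 + ∑' n, a n ^ 2 = 1) :
    Tendsto (fun r => (∫ ω, tiltedTail δ a₀ r (∑' n, a n * Y n ω - r * ∑' n, a n ^ 2)
        ∂(P.tilted fun ω => r * ∑' n, a n * Y n ω)) / foldedMass δ (r * a₀)) atTop
      (𝓝 (a₀ * (√(2 * Real.pi))⁻¹)) := by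
  obtain ⟨B, hB⟩ := exists_integral_tilted_exp_le hδ hind hlaw ha ha0
  set σ2 := ∑' n, a n ^ 2 with hσ2
  have hx : Tendsto (fun r : ℝ => r * a₀) atTop atTop := tendsto_id.atTop_mul_const ha₀
  have hmain := ((tendsto_foldedMass_div hδ).comp hx).mul
    (tendsto_integral_tilted_stdPDF hδ hind hlaw ha ha0 ha₀ hone)
  rw [one_mul] at hmain
  -- The outer `2` bounds the inverse mass; the exponential moment `B` beats nothing more than a
  -- constant, so `exp(-a₀² r)` wins.
  have herr : Tendsto (fun r : ℝ => 2 * (3 / (r * a₀) + 2 * (Real.exp (-(a₀ ^ 2 * r)) * B)))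
      atTop (𝓝 0) := by
    have h1 : Tendsto (fun r : ℝ => 3 / (r * a₀)) atTop (𝓝 0) := hx.const_div_atTop 3
    have h2 : Tendsto (fun r : ℝ => Real.exp (-(a₀ ^ 2 * r))) atTop (𝓝 0) :=
      Real.tendsto_exp_neg_atTop_nhds_zero.comp
        (tendsto_id.const_mul_atTop (by positivity : 0 < a₀ ^ 2))
    simpa using (h1.add ((h2.mul_const B).const_mul 2)).const_mul 2
  have hdiff : Tendsto (fun r => (∫ ω, tiltedTail δ a₀ r (∑' n, a n * Y n ω - r * σ2)
        ∂(P.tilted fun ω => r * ∑' n, a n * Y n ω)) / foldedMass δ (r * a₀) -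
      (1 + Real.exp (-(2 * δ * (r * a₀)))) / foldedMass δ (r * a₀) *
        ∫ ω, stdPDF ((∑' n, a n * Y n ω - r * σ2) / a₀)
        ∂(P.tilted fun ω => r * ∑' n, a n * Y n ω)) atTop (𝓝 0) := by
    refine squeeze_zero_norm' ?_ herr
    filter_upwards [eventually_gt_atTop 0] with r hr
    have := isProbabilityMeasure_tilted_tsum hδ hind hlaw ha ha0 hr.le
    have hVm := aemeasurable_tsum_mul_tilted (a := a) hlaw r
    set T := P.tilted fun ω => r * ∑' n, a n * Y n ω with hT
    obtain ⟨hei, hev⟩ := hB r hr.le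
    set c := 1 + Real.exp (-(2 * δ * (r * a₀))) with hc
    have hmass := half_le_foldedMass hδ (mul_pos hr ha₀).le
    have hmass0 := foldedMass_pos hδ (mul_pos hr ha₀).le
    have hi1 : Integrable (fun ω => c * stdPDF ((∑' n, a n * Y n ω - r * σ2) / a₀)) T := by
      refine Integrable.const_mul ?_ c
      refine Integrable.of_bound (AEMeasurable.aestronglyMeasurable (by fun_prop)) 1
        (ae_of_all _ fun ω => ?_)
      rw [Real.norm_of_nonneg (stdPDF_pos _).le]
      exact stdPDF_le_one _
    have hbd : Integrable (fun ω => 3 / (r * a₀) + 2 * (Real.exp (-(a₀ ^ 2 * r)) *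
        Real.exp (∑' n, a n * Y n ω - r * σ2))) T :=
      (integrable_const _).add ((hei.const_mul _).const_mul 2)
    have hpt : ∀ ω, ‖tiltedTail δ a₀ r (∑' n, a n * Y n ω - r * σ2) -
        c * stdPDF ((∑' n, a n * Y n ω - r * σ2) / a₀)‖ ≤
        3 / (r * a₀) + 2 * (Real.exp (-(a₀ ^ 2 * r)) *
          Real.exp (∑' n, a n * Y n ω - r * σ2)) := by
      intro ω
      refine (abs_tiltedTail_sub_le hδ ha₀ hr _).trans (le_of_eq ?_)
      rw [← Real.exp_add]
      ring_nf
    have hi2 : Integrable (fun ω => tiltedTail δ a₀ r (∑' n, a n * Y n ω - r * σ2) -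
        c * stdPDF ((∑' n, a n * Y n ω - r * σ2) / a₀)) T := by
      refine hbd.mono' ?_ (ae_of_all _ hpt)
      have := measurable_tiltedTail δ a₀ r
      exact AEMeasurable.aestronglyMeasurable (by fun_prop)
    have hi3 : Integrable (fun ω => tiltedTail δ a₀ r (∑' n, a n * Y n ω - r * σ2)) T := by
      refine (hi2.add hi1).congr (ae_of_all _ fun ω => ?_)
      simp
    have h1 : (∫ ω, tiltedTail δ a₀ r (∑' n, a n * Y n ω - r * σ2) ∂T) / foldedMass δ (r * a₀) -
        c / foldedMass δ (r * a₀) * ∫ ω, stdPDF ((∑' n, a n * Y n ω - r * σ2) / a₀) ∂T =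
        (∫ ω, (tiltedTail δ a₀ r (∑' n, a n * Y n ω - r * σ2) -
        c * stdPDF ((∑' n, a n * Y n ω - r * σ2) / a₀)) ∂T) / foldedMass δ (r * a₀) := by
      rw [integral_sub hi3 hi1, integral_const_mul]
      ring
    rw [h1, norm_div, Real.norm_of_nonneg hmass0.le, div_le_iff₀ hmass0]
    have h2 := norm_integral_le_of_norm_le hbd (ae_of_all _ hpt)
    rw [integral_add (integrable_const _) ((hei.const_mul _).const_mul 2), integral_const_mul,
      integral_const_mul] at h2
    simp only [integral_const, probReal_univ, one_smul] at h2
    have h3 : 3 / (r * a₀) + 2 * (Real.exp (-(a₀ ^ 2 * r)) *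
        ∫ ω, Real.exp (∑' n, a n * Y n ω - r * σ2) ∂T) ≤
        3 / (r * a₀) + 2 * (Real.exp (-(a₀ ^ 2 * r)) * B) := by gcongr
    have h4 : 0 ≤ 3 / (r * a₀) + 2 * (Real.exp (-(a₀ ^ 2 * r)) * B) :=
      (norm_nonneg _).trans (h2.trans h3)
    nlinarith
  have := hdiff.add hmain
  rw [zero_add] at this
  exact this.congr fun r => sub_add_cancel _ _

end Tilted

/-! ### Exact tail asymptotics for normalised weights -/

section Tail

variable {δ : ℝ} {a : ℕ → ℝ} {Ω : Type*} [MeasurableSpace Ω] {P : Measure Ω} {Y : ℕ → Ω → ℝ}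

/-- The series is measurable for the σ-algebra generated by the variables of index at least one.
This needs genuine measurability, not only almost everywhere. -/
lemma indepFun_tsum_succ_zero (hY : ∀ n, Measurable (Y n)) (hind : iIndepFun Y P) (b : ℕ → ℝ) :
    IndepFun (fun ω => ∑' n, b n * Y (n + 1) ω) (Y 0) P := by
  have h1 := indep_iSup_of_disjoint (fun n => (hY n).comap_le) hind.iIndep
    (S := {0}ᶜ) (T := {0}) disjoint_compl_left
  rw [IndepFun_iff_Indep]
  refine indep_of_indep_of_le_left (indep_of_indep_of_le_right h1 ?_) ?_
  · simp
  · rw [← measurable_iff_comap_le]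
    refine @Measurable.tsum Ω ℝ ℕ (⨆ i ∈ ({0}ᶜ : Set ℕ), MeasurableSpace.comap (Y i) _)
      _ _ _ _ _ _ _ _ _ _ _ _ fun n => ?_
    refine (measurable_const_mul (b n)).comp (measurable_iff_comap_le.2 ?_)
    exact le_iSup₂_of_le (n + 1) (by simp) le_rfl

/-- Exact tail asymptotics for weighted sums of i.i.d. centred folded normal variables. -/
theorem tendsto_tail_div (hδ : 0 ≤ δ) (hY : ∀ n, Measurable (Y n)) (hind : iIndepFun Y P)
    (hlaw : ∀ n, HasLaw (Y n) (foldedLaw δ) P) (ha : Summable a) (ha0 : ∀ n, 0 < a n)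
    (hone : ∑' n, a n ^ 2 = 1) :
    Tendsto (fun r => P.real {ω | r ≤ ∑' n, a n * Y n ω} /
      (Real.exp (-(r ^ 2 / 2) + logMass δ a r) / (r * √(2 * Real.pi)))) atTop (𝓝 1) := by
  have hprob := hind.isProbabilityMeasure
  set b : ℕ → ℝ := fun n => a (n + 1) with hb
  set X : ℕ → Ω → ℝ := fun n => Y (n + 1) with hX
  have hbs : Summable b := (summable_nat_add_iff 1).2 ha
  have hb0 : ∀ n, 0 < b n := fun n => ha0 _
  have hXind : iIndepFun X P := hind.precomp (add_left_injective 1)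
  have hXlaw : ∀ n, HasLaw (X n) (foldedLaw δ) P := fun n => hlaw _
  have hone' : a 0 ^ 2 + ∑' n, b n ^ 2 = 1 := by
    rw [← hone, (summable_sq_of_summable ha fun n => (ha0 n).le).tsum_eq_zero_add]
  set σ2 := ∑' n, b n ^ 2 with hσ2
  set V : Ω → ℝ := fun ω => ∑' n, b n * X n ω with hV
  have hVm : Measurable V := Measurable.tsum fun n => (hY (n + 1)).const_mul _
  -- Conditioning on `V`, the sum without its term of index `0`, produces the factor `exp(r V)`,
  -- which is absorbed by tilting the measure.
  have htail : ∀ r, 0 < r → P.real {ω | r ≤ ∑' n, a n * Y n ω} =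
      Real.exp (-(r ^ 2 / 2) + logMass δ b r) / (r * a 0) *
        ∫ ω, tiltedTail δ (a 0) r (V ω - r * σ2) ∂(P.tilted fun ω => r * V ω) := by
    intro r hr
    have h1 : P.real {ω | r ≤ ∑' n, a n * Y n ω} = P.real {ω | r ≤ a 0 * Y 0 ω + V ω} := by
      refine measureReal_congr ?_
      filter_upwards [ae_summable_mul hδ hlaw ha fun n => (ha0 n).le] with ω hω
      refine propext ?_
      change r ≤ ∑' n, a n * Y n ω ↔ r ≤ a 0 * Y 0 ω + V ω
      rw [hω.tsum_eq_zero_add]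
    have hS : MeasurableSet {p : ℝ × ℝ | r ≤ a 0 * p.2 + p.1} :=
      measurableSet_le measurable_const (by fun_prop)
    have h2 : P.real {ω | r ≤ a 0 * Y 0 ω + V ω} =
        ∫ ω, (foldedLaw δ).real {y | r ≤ a 0 * y + V ω} ∂P := by
      have hfin : IsProbabilityMeasure (foldedLaw δ) := by
        rw [← (hlaw 0).map_eq]
        exact Measure.isProbabilityMeasure_map (hlaw 0).aemeasurable
      have hmap := (indepFun_iff_map_prod_eq_prod_map_map hVm.aemeasurable
        (hY 0).aemeasurable).1 (indepFun_tsum_succ_zero hY hind b)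
      rw [(hlaw 0).map_eq] at hmap
      have h3 : P {ω | r ≤ a 0 * Y 0 ω + V ω} =
          ∫⁻ ω, foldedLaw δ {y | r ≤ a 0 * y + V ω} ∂P := by
        have h4 := Measure.map_apply (μ := P) (hVm.prodMk (hY 0)) hS
        rw [hmap, Measure.prod_apply hS,
          lintegral_map (measurable_measure_prodMk_left hS) hVm] at h4
        exact h4.symm
      have hm : Measurable fun ω => foldedLaw δ {y | r ≤ a 0 * y + V ω} :=
        (measurable_measure_prodMk_left (ν := foldedLaw δ) hS).comp hVm
      rw [measureReal_def, h3]
      simp_rw [measureReal_def]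
      rw [integral_toReal hm.aemeasurable (ae_of_all _ fun ω => measure_lt_top _ _)]
    obtain ⟨hi, hv⟩ := integrable_and_integral_exp_tsum hδ hXind hXlaw hbs
      (fun n => (hb0 n).le) hr.le
    rw [← hσ2] at hv
    rw [h1, h2, integral_tilted, hv]
    simp_rw [foldedLaw_real_tail_eq (ha0 0) hr hone', ← integral_const_mul]
    refine integral_congr_ae (ae_of_all _ fun ω => ?_)
    simp only [smul_eq_mul]
    have h5 : Real.exp (-(r ^ 2 / 2) - r ^ 2 / 2 * σ2) *
        Real.exp (r ^ 2 / 2 * σ2 + logMass δ b r) = Real.exp (-(r ^ 2 / 2) + logMass δ b r) := by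
      rw [← Real.exp_add]; ring_nf
    rw [← h5]
    have h6 := (Real.exp_pos (r ^ 2 / 2 * σ2 + logMass δ b r)).ne'
    field_simp
  have hlim := (tendsto_integral_tilted_tiltedTail hδ hXind hXlaw hbs hb0 (ha0 0) hone').mul_const
    (√(2 * Real.pi) / a 0)
  have hpi : 0 < √(2 * Real.pi) := by positivity
  have ha00 := ha0 0
  have hc : a 0 * (√(2 * Real.pi))⁻¹ * (√(2 * Real.pi) / a 0) = 1 := by field_simp
  rw [hc] at hlim
  refine hlim.congr' ?_
  filter_upwards [eventually_gt_atTop 0] with r hr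
  have hmass := foldedMass_pos hδ (mul_pos hr ha00).le
  -- The factor `foldedMass δ (r * a 0)` split off here is the one dividing the tilted expectation
  -- in `hlim`.
  have hlog : logMass δ a r = Real.log (foldedMass δ (r * a 0)) + logMass δ b r :=
    (summable_log_foldedMass hδ ha (fun n => (ha0 n).le) hr.le).tsum_eq_zero_add
  rw [htail r hr, hlog, add_left_comm, Real.exp_add (Real.log _), Real.exp_log hmass]
  have h6 := (Real.exp_pos (-(r ^ 2 / 2) + logMass δ b r)).ne'
  simp only [hV, hσ2]
  field_simp

end Tail

/-! ### Return to the Gaussian variables -/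

lemma l2Norm_pos {a : ℕ → ℝ} (ha : Summable a) (ha0 : ∀ n, 0 < a n) : 0 < l2Norm a :=
  Real.sqrt_pos.2 ((summable_sq_of_summable ha fun n => (ha0 n).le).tsum_pos
    (fun _ => sq_nonneg _) 0 (pow_pos (ha0 0) 2))

lemma tsum_div_l2Norm_sq {a : ℕ → ℝ} (ha : Summable a) (ha0 : ∀ n, 0 < a n) :
    ∑' n, (a n / l2Norm a) ^ 2 = 1 := by
  simp_rw [div_pow]
  have h := l2Norm_pos ha ha0
  rw [tsum_div_const, div_eq_one_iff_eq (by positivity), l2Norm, Real.sq_sqrt]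
  exact tsum_nonneg fun n => sq_nonneg _

section UpperTail

variable {Ω : Type*} [MeasurableSpace Ω] {P : Measure Ω} {α β : ℝ} {Z : ℕ → Ω → ℝ} {a : ℕ → ℝ}

lemma ae_summable_mul_abs_gaussian
    (hZ : ∀ n, HasLaw (Z n) (gaussianReal α (Real.toNNReal (β ^ 2))) P)
    (ha : Summable a) (ha0 : ∀ n, 0 < a n) : ∀ᵐ ω ∂P, Summable fun n => a n * |Z n ω| := by
  refine ae_summable_mul_of_lintegral_le (X := fun n ω => |Z n ω|)
    (fun n => ?_) (M := ∫⁻ z, ‖z‖ₑ ∂gaussianReal α (Real.toNNReal (β ^ 2))) ?_ (fun n => ?_)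
    ha fun n => (ha0 n).le
  · have := (hZ n).aemeasurable
    exact continuous_abs.measurable.comp_aemeasurable this
  · have h : Integrable id (gaussianReal α (Real.toNNReal (β ^ 2))) :=
      memLp_one_iff_integrable.1 (memLp_id_gaussianReal 1)
    exact h.2.ne
  · rw [← (hZ n).lintegral_comp (f := fun w => ‖w‖ₑ) (by fun_prop)]
    refine le_of_eq (lintegral_congr fun ω => ?_)
    rw [← Real.norm_eq_abs, enorm_norm]

/-- For `β < 0` the threshold tends to `-∞` while the sum is nonnegative (a divergent `tsum` being
`0`). For `β = 0` all `Zₙ` equal `α` almost surely and the sum equals the threshold. -/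
lemma eventually_upperTail_eq_one [IsProbabilityMeasure P] (hβ : β ≤ 0)
    (hZ : ∀ n, HasLaw (Z n) (gaussianReal α (Real.toNNReal (β ^ 2))) P)
    (ha : Summable a) (ha0 : ∀ n, 0 < a n) : ∀ᶠ r in atTop, upperTail P Z α β a r = 1 := by
  rcases hβ.lt_or_eq with h | rfl
  · have h1 : Tendsto (fun r => r * l2Norm a * β + |α| * ∑' n, a n) atTop atBot :=
      tendsto_atBot_add_const_right _ _ (Tendsto.atTop_mul_const_of_neg h
        (tendsto_id.atTop_mul_const (l2Norm_pos ha ha0)))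
    filter_upwards [h1.eventually (eventually_le_atBot 0)] with r hr
    have : {ω | r * l2Norm a * β + |α| * ∑' n, a n ≤ ∑' n, a n * |Z n ω|} = Set.univ :=
      Set.eq_univ_of_forall fun ω => hr.trans
        (tsum_nonneg fun n => mul_nonneg (ha0 n).le (abs_nonneg _))
    rw [upperTail, this, probReal_univ]
  · refine Eventually.of_forall fun r => ?_
    have h1 : ∀ᵐ ω ∂P, ∀ n, Z n ω = α := by
      rw [ae_all_iff]
      intro n
      have h := hZ n
      simp only [ne_eq, OfNat.ofNat_ne_zero, not_false_eq_true, zero_pow, Real.toNNReal_zero,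
        gaussianReal_zero_var] at h
      exact h.ae_eq_of_dirac
    have h2 : P.real {ω | r * l2Norm a * 0 + |α| * ∑' n, a n ≤ ∑' n, a n * |Z n ω|} =
        P.real Set.univ := by
      refine measureReal_congr ?_
      filter_upwards [h1] with ω hω
      refine propext ⟨fun _ => trivial, fun _ => ?_⟩
      change r * l2Norm a * 0 + |α| * ∑' n, a n ≤ ∑' n, a n * |Z n ω|
      simp_rw [hω]
      rw [tsum_mul_right]
      linarith
    rw [upperTail, h2, probReal_univ]

lemma upperTail_isEquivalent (hβ : 0 < β) (hind : iIndepFun Z P)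
    (hZ : ∀ n, HasLaw (Z n) (gaussianReal α (Real.toNNReal (β ^ 2))) P)
    (ha : Summable a) (ha0 : ∀ n, 0 < a n) :
    (fun r => upperTail P Z α β a r) ~[atTop] fun r =>
      Real.exp (-(r ^ 2 / 2) + logMass (|α| / β) (fun n => a n / l2Norm a) r) /
        (r * √(2 * Real.pi)) := by
  have hδ : 0 ≤ |α| / β := by positivity
  have hW : ∀ n, HasLaw (fun ω => |Z n ω| / β - |α| / β) (foldedLaw (|α| / β)) P :=
    fun n => hasLaw_abs_div_sub hβ (hZ n)
  -- Measurable modifications; they change neither the laws, nor independence, nor the probability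
  -- of the event.
  set Y : ℕ → Ω → ℝ := fun n => (hW n).aemeasurable.mk _ with hYdef
  have hYW : ∀ n, (fun ω => |Z n ω| / β - |α| / β) =ᵐ[P] Y n :=
    fun n => (hW n).aemeasurable.ae_eq_mk
  have hYm : ∀ n, Measurable (Y n) := fun n => (hW n).aemeasurable.measurable_mk
  have hYlaw : ∀ n, HasLaw (Y n) (foldedLaw (|α| / β)) P := fun n => (hW n).congr (hYW n).symm
  have hYind : iIndepFun Y P :=
    (hind.comp (fun _ z => |z| / β - |α| / β) (fun _ => by fun_prop)).congr hYW
  have hn := l2Norm_pos ha ha0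
  have ha' : Summable fun n => a n / l2Norm a := ha.div_const _
  have h := tendsto_tail_div hδ hYm hYind hYlaw ha' (fun n => div_pos (ha0 n) hn)
    (tsum_div_l2Norm_sq ha ha0)
  rw [isEquivalent_iff_tendsto_one]
  · refine h.congr fun r => ?_
    simp only [Pi.div_apply]
    congr 1
    refine measureReal_congr ?_
    filter_upwards [ae_all_iff.2 hYW, ae_summable_mul hδ hYlaw ha fun n => (ha0 n).le]
      with ω h1 h2
    refine propext ?_
    change r ≤ ∑' n, a n / l2Norm a * Y n ω ↔
      r * l2Norm a * β + |α| * ∑' n, a n ≤ ∑' n, a n * |Z n ω|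
    have e1 : ∀ n, a n * |Z n ω| = β * (a n * Y n ω) + |α| * a n := by
      intro n
      rw [← h1 n]
      field_simp
      ring
    have e2 : ∀ n, a n / l2Norm a * Y n ω = (a n * Y n ω) / l2Norm a := fun n => by ring
    simp_rw [e1, e2]
    rw [(h2.mul_left β).tsum_add (ha.mul_left |α|), tsum_mul_left, tsum_mul_left, tsum_div_const,
      add_le_add_iff_right, le_div_iff₀ hn, mul_comm β, mul_le_mul_iff_left₀ hβ]
  · filter_upwards [eventually_gt_atTop 0] with r hr
    positivity

end UpperTail

theorem theorem2p2 {Ω : Type*} [MeasurableSpace Ω] (P : Measure Ω) [IsProbabilityMeasure P]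
    (α β : ℝ) (Z : ℕ → Ω → ℝ)
    (hZ_indep : iIndepFun Z P)
    (hZ_law : ∀ n, HasLaw (Z n) (gaussianReal α (Real.toNNReal (β ^ 2))) P)
    (a b : ℕ → ℝ)
    (ha_anti : Antitone a) (hb_anti : Antitone b)
    (ha_pos : ∀ n, 0 < a n) (hb_pos : ∀ n, 0 < b n)
    (ha_sum : Summable a) (hb_sum : Summable b)
    (hconv : ∃ L : ℝ, Tendsto (fun N => ∑ n ∈ Finset.range N, relDefect a b n) atTop (𝓝 L))
    (hsq : Summable (fun n => relDefect a b n ^ 2)) :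
    (∀ᵐ ω ∂P, Summable (fun n => a n * |Z n ω|) ∧ Summable (fun n => b n * |Z n ω|)) ∧
    (fun r : ℝ => upperTail P Z α β a r) ~[atTop] (fun r : ℝ => upperTail P Z α β b r) := by
  refine ⟨(ae_summable_mul_abs_gaussian hZ_law ha_sum ha_pos).and
    (ae_summable_mul_abs_gaussian hZ_law hb_sum hb_pos), ?_⟩
  rcases le_or_gt β 0 with hβ | hβ
  · refine EventuallyEq.isEquivalent ?_
    filter_upwards [eventually_upperTail_eq_one hβ hZ_law ha_sum ha_pos,
      eventually_upperTail_eq_one hβ hZ_law hb_sum hb_pos] with r h1 h2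
    rw [h1, h2]
  · have hδ : 0 ≤ |α| / β := by positivity
    have hna := l2Norm_pos ha_sum ha_pos
    have hnb := l2Norm_pos hb_sum hb_pos
    obtain ⟨L', L'', C, hC, h1, h2, h3, h4⟩ := exists_log_foldedMass_deriv_bounds hδ
    have hcmp := tendsto_tsum_sub_tsum_of_relative_perturbation
      (by rw [foldedMass_zero, Real.log_one]) hC h1 h2 h3 h4
      (a := fun n => a n / l2Norm a) (b := fun n => b n / l2Norm b) (d := relDefect a b)
      (fun n => div_pos (ha_pos n) hna) (fun n => div_pos (hb_pos n) hnb)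
      (fun m n hmn => div_le_div_of_nonneg_right (hb_anti hmn) hnb.le)
      (ha_sum.div_const _) (hb_sum.div_const _)
      (fun n => by
        have := hb_pos n
        rw [relDefect]
        field_simp
        ring) hconv hsq
    refine (upperTail_isEquivalent hβ hZ_indep hZ_law ha_sum ha_pos).trans
      (IsEquivalent.trans ?_ (upperTail_isEquivalent hβ hZ_indep hZ_law hb_sum hb_pos).symm)
    rw [isEquivalent_iff_tendsto_one]
    -- The factor `exp(-r²/2)/(r√(2π))` is common to both tails, so only the difference of the two
    -- `logMass` terms survives.
    · have hexp := (Real.continuous_exp.tendsto 0).comp hcmp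
      rw [Real.exp_zero] at hexp
      refine hexp.congr' ?_
      filter_upwards [eventually_gt_atTop 0] with r hr
      have hpi : 0 < √(2 * Real.pi) := by positivity
      simp only [Pi.div_apply, Function.comp_apply]
      rw [div_div_div_cancel_right₀ (by positivity), ← Real.exp_sub, logMass, logMass,
        add_sub_add_left_eq_sub]
    · filter_upwards [eventually_gt_atTop 0] with r hr
      positivity
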